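/- **Setting.** Consider $\min f(x)$ subject to $c_i(x)=0$ $(i\in\mathcal E)$, $c_i(x)\ge 0$ $(i\in\mathcal I)$, $x\in\mathbb R^n$, with finite index sets, affine $c_i$ and nonempty feasible set $\Omega$. Let $D\subset\mathbb R^n$ be convex and compact, $\Omega\subseteq D\subseteq O$ with $O$ open, and let $f$ be Lipschitz and upper-$C^2$ on $O$ (near each point of $O$ it is a minimum $\min_{t\in T}p(t,x)$ over a compact space $T$ of $C^2$ functions of $x$ which are jointly continuous in $(t,x)$ together with their $x$-derivatives of order $\le 2$). Let $\rho>0$ be such that $-f+\frac{\rho}{2}\|\cdot\|^2$ is convex on $D$. Write $v(x)=\sum_{i\in\mathcal E}|c_i(x)|+\sum_{i\in\mathcal I}\max\{0,-c_i(x)\}$ and $\phi(x,\theta)=f(x)+\theta v(x)$. **Algorithm.** Let $\eta,\tau\in(0,1)$, $\gamma>0$, $\theta_0>0$ and let $x_0$ be given. In iteration $k$ choose a Clarke subgradient $g_k\in\bar\partial f(x_k)$ and a symmetric matrix $B_k$; let $d_k$ (with slacks $v^k,w^k,t^k$) solve $$\min_{d,v,w,t}\ f(x_k)+g_k^Td+\tfrac12d^TB_kd+\theta_k\sum_{i\in\mathcal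 E}(v_i+w_i)+\theta_k\sum_{i\in\mathcal I}t_i$$ subject to $c_i(x_k)+\nabla c_i(x_k)^Td=v_i-w_i$ $(i\in\mathcal E)$, $c_i(x_k)+\nabla c_i(x_k)^Td\ge -t_i$ $(i\in\mathcal I)$, $v,w,t\ge0$, and let $\lambda^{k+1}$ be a vector of Lagrange multipliers of the linearized constraints. Put $\theta_{k+1}=\max\{\theta_k,\|\lambda^{k+1}\|_\infty+\gamma\}$, let $\alpha_k$ be the first of $1,\tau,\tau^2,\dots$ with $\phi(x_k,\theta_k)-\phi(x_k+\alpha_kd_k,\theta_k)\ge\eta\,\alpha_k\frac12d_k^TB_kd_k$, and put $x_{k+1}=x_k+\alpha_kd_k$. Consider an infinite run, and assume that $x_k\in D$ and $x_k+d_k\in D$ for all $k$, that $(B_k)$ is bounded and $d^TB_kd\ge b\|d\|^2$ for all $k$ and $d$, with a constant $b>0$, and that at every accumulation point $x$ of $(x_k)$ the Mangasarian–Fromovitz constraint qualification holds: the $\nabla c_i(x)$, $i\in\mathcal E$, are linearly independent and there is $w$ with $\nabla c_i(x)^Tw=0$ for $i\in\mathcal E$ and $\nabla c_i(x)^Tw>0$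 for all $i\in\mathcal I$ with $c_i(x)=0$. **Potential function.** For $\sigma,l>0$ let $F=-f+\frac{\sigma}{2}\|\cdot\|^2$ on $D$ and $F=+\infty$ elsewhere, let $F^*$ be its conjugate, and let $$L(x,y,w)=-y^Tx+F^*(y)+\tfrac{\sigma}{2}\|x\|^2+\tfrac{l}{2}\|x-w\|^2+i_{\bar C}(x,w),$$ where $i_{\bar C}(x,w)$ is $0$ if $c_i(w)+\nabla c_i(w)^T(x-w)$ is $=0$ for $i\in\mathcal E$ and $\ge0$ for $i\in\mathcal I$, and $+\infty$ otherwise. Assume that $L$ is a KL function with exponent $\alpha\in(0,\frac12]$: with $\partial L$ the limiting subdifferential, for each $\hat z\in\operatorname{dom}\partial L$ there are $\epsilon\in(0,\infty]$, a neighbourhood $U$ of $\hat z$ and $a_0>0$ such that, with $\varphi(s)=a_0s^{1-\alpha}$, $$\varphi'\bigl(L(z)-L(\hat z)\bigr)\,\operatorname{dist}(0,\partial L(z))\ge1\quad\text{for all } z\in U \text{ with } L(\hat z)<L(z)<L(\hat z)+\epsilon .$$ **Theorem.** If $b\ge\sigma\ge\rho$ and $2b\ge\sigma+l$, then $(x_k)$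 converges to some $\bar x\in\mathbb R^n$, and there are $q_0\in(0,1)$ and $q_1>0$ such that $\|x_k-\bar x\|\le q_1q_0^k$ for all sufficiently large $k$. -/

import Mathlib

open Set Filter Topology

namespace NonsmoothSQP

noncomputable section

section Nonsmooth

/-- Lower regular (Fréchet) subgradients of an extended-real-valued function at a point where it is
finite: `liminf (h y - h x - ⟪g, y - x⟫) / ‖y - x‖ ≥ 0` as `y → x`, `y ≠ x`. -/
def regularSubdiff {Z : Type*} [NormedAddCommGroup Z] [InnerProductSpace ℝ Z]
    (h : Z → EReal) (x : Z) : Set Z :=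
  {g | h x ≠ ⊤ ∧ h x ≠ ⊥ ∧ ∀ ε : ℝ, 0 < ε →
    ∀ᶠ y in 𝓝 x, h x + ((inner ℝ g (y - x) - ε * ‖y - x‖ : ℝ) : EReal) ≤ h y}

/-- Lower general (limiting) subgradients of an extended-real-valued function. -/
def limitingSubdiff {Z : Type*} [NormedAddCommGroup Z] [InnerProductSpace ℝ Z]
    (h : Z → EReal) (x : Z) : Set Z :=
  {g | h x ≠ ⊤ ∧ h x ≠ ⊥ ∧ ∃ (u : ℕ → Z) (s : ℕ → Z),
    Tendsto u atTop (𝓝 x) ∧ Tendsto (fun j => h (u j)) atTop (𝓝 (h x)) ∧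
    (∀ j, s j ∈ regularSubdiff h (u j)) ∧ Tendsto s atTop (𝓝 g)}

/-- The Clarke generalized directional derivative
`limsup (f (y + t v) - f y) / t` as `y → x`, `t ↓ 0`. -/
def clarkeDeriv {X : Type*} [NormedAddCommGroup X] [InnerProductSpace ℝ X]
    (f : X → ℝ) (x v : X) : EReal :=
  limsup (fun p : X × ℝ => (((f (p.1 + p.2 • v) - f p.1) / p.2 : ℝ) : EReal))
    (𝓝 x ×ˢ 𝓝[>] (0 : ℝ))

/-- The Clarke subdifferential of a locally Lipschitz function. -/
def clarkeSubdiff {X : Type*} [NormedAddCommGroup X] [InnerProductSpace ℝ X]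
    (f : X → ℝ) (x : X) : Set X :=
  {g | ∀ v : X, ((inner ℝ g v : ℝ) : EReal) ≤ clarkeDeriv f x v}

/-- `f` is upper-`C²` on `O`: near each point of `O` it is a minimum, over a compact index space
`T`, of functions `p t` of class `C²`, which are continuous in `(t, x)` together with their
derivatives in `x` of order at most two. -/
def UpperC2On {X : Type*} [NormedAddCommGroup X] [InnerProductSpace ℝ X]
    (f : X → ℝ) (O : Set X) : Prop :=
  ∀ x₀ ∈ O, ∃ V : Set X, IsOpen V ∧ x₀ ∈ V ∧
    ∃ (T : Type) (_ : TopologicalSpace T) (_ : CompactSpace T) (p : T → X → ℝ),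
      (∀ t, ContDiffOn ℝ 2 (p t) V) ∧
      (∀ j : ℕ, j ≤ 2 →
        ContinuousOn (fun q : T × X => iteratedFDeriv ℝ j (p q.1) q.2) (univ ×ˢ V)) ∧
      ∀ x ∈ V, IsLeast (range fun t => p t x) (f x)

/-- A continuous concave function `φ : [0, η) → [0, ∞)` with `φ 0 = 0` which is `C¹` with positive
derivative on `(0, η)`; here `η ∈ (0, ∞]`. -/
structure IsDesingularizing (η : EReal) (φ : ℝ → ℝ) : Prop where
  eta_pos : 0 < η
  continuousOn : ContinuousOn φ {s : ℝ | 0 ≤ s ∧ (s : EReal) < η}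
  concaveOn : ConcaveOn ℝ {s : ℝ | 0 ≤ s ∧ (s : EReal) < η} φ
  nonneg : ∀ s : ℝ, 0 ≤ s → (s : EReal) < η → 0 ≤ φ s
  map_zero : φ 0 = 0
  contDiffOn : ContDiffOn ℝ 1 φ {s : ℝ | 0 < s ∧ (s : EReal) < η}
  deriv_pos : ∀ s : ℝ, 0 < s → (s : EReal) < η → 0 < deriv φ s

/-- The Kurdyka-Łojasiewicz inequality `φ' (h z - h z₀) * dist (0, ∂h z) ≥ 1` on the part of `U`
where `h z₀ < h z < h z₀ + η`.  The distance to the empty set is `∞`. -/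
def KLInequality {Z : Type*} [NormedAddCommGroup Z] [InnerProductSpace ℝ Z]
    (h : Z → EReal) (z₀ : Z) (η : EReal) (U : Set Z) (φ : ℝ → ℝ) : Prop :=
  ∀ z ∈ U, h z₀ < h z → h z < h z₀ + η →
    1 ≤ ENNReal.ofReal (deriv φ (h z - h z₀).toReal) *
      Metric.infEDist (0 : Z) (limitingSubdiff h z)

/-- `h` is a KL function with exponent `α`: at every point of `dom ∂h` the KL property holds with
a desingularizing function of the form `s ↦ a₀ * s ^ (1 - α)`. -/
def IsKLFunctionWithExponent {Z : Type*} [NormedAddCommGroup Z] [InnerProductSpace ℝ Z]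
    (h : Z → EReal) (α : ℝ) : Prop :=
  ∀ z₀ : Z, (limitingSubdiff h z₀).Nonempty →
    ∃ (η : EReal) (U : Set Z) (a₀ : ℝ), U ∈ 𝓝 z₀ ∧
      IsDesingularizing η (fun s => a₀ * s ^ (1 - α)) ∧
      KLInequality h z₀ η U (fun s => a₀ * s ^ (1 - α))

/-- The conjugate function `u ↦ sup_x (⟪u, x⟫ - F x)`. -/
def conjugate {X : Type*} [NormedAddCommGroup X] [InnerProductSpace ℝ X]
    (F : X → EReal) (u : X) : EReal :=
  ⨆ x : X, ((inner ℝ u x : ℝ) : EReal) - F x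

end Nonsmooth

/-- The data of the problem: minimize `f x` subject to `cE i x = 0` and `cI i x ≥ 0`. -/
structure Problem (X ιE ιI : Type*) where
  f : X → ℝ
  cE : ιE → X → ℝ
  cI : ιI → X → ℝ

namespace Problem

variable {X ιE ιI : Type*} [NormedAddCommGroup X] [InnerProductSpace ℝ X] [CompleteSpace X]

/-- The feasible region. -/
def feasible (P : Problem X ιE ιI) : Set X :=
  {x | (∀ i, P.cE i x = 0) ∧ ∀ i, 0 ≤ P.cI i x}

/-- All constraint functions are affine. -/
def AffineConstraints (P : Problem X ιE ιI) : Prop :=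
  (∀ i, ∃ A : X →ᵃ[ℝ] ℝ, P.cE i = A) ∧ ∀ i, ∃ A : X →ᵃ[ℝ] ℝ, P.cI i = A

/-- The linearization at `w` of the equality constraints, evaluated at `x`. -/
def linE (P : Problem X ιE ιI) (i : ιE) (x w : X) : ℝ :=
  P.cE i w + inner ℝ (gradient (P.cE i) w) (x - w)

/-- The linearization at `w` of the inequality constraints, evaluated at `x`. -/
def linI (P : Problem X ιE ιI) (i : ιI) (x w : X) : ℝ :=
  P.cI i w + inner ℝ (gradient (P.cI i) w) (x - w)

/-- The constraint violation `∑ |c_i x| + ∑ max 0 (-c_i x)`. -/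
def violation [Fintype ιE] [Fintype ιI] (P : Problem X ιE ιI) (x : X) : ℝ :=
  ∑ i, |P.cE i x| + ∑ i, max 0 (-P.cI i x)

/-- The `ℓ₁` merit function. -/
def merit [Fintype ιE] [Fintype ιI] (P : Problem X ιE ιI) (x : X) (θ : ℝ) : ℝ :=
  P.f x + θ * P.violation x

/-- The Mangasarian-Fromovitz constraint qualification at `x`. -/
def MFCQ (P : Problem X ιE ιI) (x : X) : Prop :=
  LinearIndependent ℝ (fun i => gradient (P.cE i) x) ∧
    ∃ w : X, (∀ i, P.cI i x = 0 → 0 < inner ℝ (gradient (P.cI i) x) w) ∧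
      ∀ i, inner ℝ (gradient (P.cE i) x) w = 0

/-- The function equal to `-f x + (σ/2) ‖x‖²` on `D` and to `∞` elsewhere. -/
def convexPart (P : Problem X ιE ιI) (D : Set X) (σ : ℝ) (x : X) : EReal :=
  open Classical in
  if x ∈ D then ((-P.f x + σ / 2 * ‖x‖ ^ 2 : ℝ) : EReal) else ⊤

/-- The indicator function of the pairs `(x, w)` such that `x` satisfies the constraints
linearized at `w`. -/
def linIndicator (P : Problem X ιE ιI) (x w : X) : EReal :=
  open Classical in
  if (∀ i, P.linE i x w = 0) ∧ ∀ i, 0 ≤ P.linI i x w then 0 else ⊤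

/-- The potential function
`L (x, y, w) = -⟪y, x⟫ + F* y + (σ/2) ‖x‖² + (l/2) ‖x - w‖² + indicator (x, w)`
on the Euclidean product of three copies of `X`, with `(x, y, w) = (z 0, z 1, z 2)`. -/
def potential (P : Problem X ιE ιI) (D : Set X) (σ l : ℝ)
    (z : PiLp 2 (fun _ : Fin 3 => X)) : EReal :=
  ((-inner ℝ (z 1) (z 0) : ℝ) : EReal) + conjugate (P.convexPart D σ) (z 1)
    + ((σ / 2 * ‖z 0‖ ^ 2 + l / 2 * ‖z 0 - z 2‖ ^ 2 : ℝ) : EReal)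
    + P.linIndicator (z 0) (z 2)

/-- Feasibility of `(d, v, w, t)` for the relaxed quadratic subproblem at `x`. -/
def SubFeasible (P : Problem X ιE ιI) (x d : X) (v w : ιE → ℝ) (t : ιI → ℝ) : Prop :=
  (∀ i, P.cE i x + inner ℝ (gradient (P.cE i) x) d = v i - w i) ∧
  (∀ i, -t i ≤ P.cI i x + inner ℝ (gradient (P.cI i) x) d) ∧
  (∀ i, 0 ≤ v i) ∧ (∀ i, 0 ≤ w i) ∧ ∀ i, 0 ≤ t i

/-- Objective of the relaxed quadratic subproblem at `x`, with subgradient `g`, quadratic term `B`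
and penalty parameter `θ`. -/
def subObjective [Fintype ιE] [Fintype ιI] (P : Problem X ιE ιI) (x g : X) (B : X →L[ℝ] X)
    (θ : ℝ) (d : X) (v w : ιE → ℝ) (t : ιI → ℝ) : ℝ :=
  (P.f x + inner ℝ g d + 1 / 2 * inner ℝ d (B d)) + θ * ∑ i, (v i + w i) + θ * ∑ i, t i

/-- `(d, v, w, t)` solves the relaxed quadratic subproblem. -/
def IsSubSolution [Fintype ιE] [Fintype ιI] (P : Problem X ιE ιI) (x g : X) (B : X →L[ℝ] X)
    (θ : ℝ) (d : X) (v w : ιE → ℝ) (t : ιI → ℝ) : Prop :=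
  P.SubFeasible x d v w t ∧
    ∀ (d' : X) (v' w' : ιE → ℝ) (t' : ιI → ℝ), P.SubFeasible x d' v' w' t' →
      P.subObjective x g B θ d v w t ≤ P.subObjective x g B θ d' v' w' t'

/-- `(lamE, lamI)` are Lagrange multipliers of the linearized constraints at the solution
`(d, v, w, t)` of the relaxed quadratic subproblem: together with multipliers `p`, `q`, `r` of the
bounds on the slack variables they satisfy the first-order optimality conditions. -/
def IsSubMultiplier [Fintype ιE] [Fintype ιI] (P : Problem X ιE ιI) (x g : X) (B : X →L[ℝ] X)
    (θ : ℝ) (d : X) (v w : ιE → ℝ) (t : ιI → ℝ) (lamE : ιE → ℝ) (lamI : ιI → ℝ) : Prop :=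
  g + B d - (∑ i, lamE i • gradient (P.cE i) x + ∑ i, lamI i • gradient (P.cI i) x) = 0 ∧
  (∀ i, 0 ≤ lamI i) ∧
  (∀ i, lamI i * (P.cI i x + inner ℝ (gradient (P.cI i) x) d + t i) = 0) ∧
  ∃ (p q : ιE → ℝ) (r : ιI → ℝ),
    (∀ i, 0 ≤ p i) ∧ (∀ i, 0 ≤ q i) ∧ (∀ i, 0 ≤ r i) ∧
    (∀ i, θ + lamE i - p i = 0) ∧ (∀ i, θ - lamE i - q i = 0) ∧ (∀ i, θ - lamI i - r i = 0) ∧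
    (∀ i, p i * v i = 0) ∧ (∀ i, q i * w i = 0) ∧ ∀ i, r i * t i = 0

end Problem

/-- The sequences produced by the line search SQP method.  `lamE k` and `lamI k` are the
multipliers computed in iteration `k`. -/
structure SQPSequences (X ιE ιI : Type*) [NormedAddCommGroup X] [InnerProductSpace ℝ X] where
  x : ℕ → X
  g : ℕ → X
  B : ℕ → X →L[ℝ] X
  d : ℕ → X
  v : ℕ → ιE → ℝ
  w : ℕ → ιE → ℝ
  t : ℕ → ιI → ℝ
  lamE : ℕ → ιE → ℝ
  lamI : ℕ → ιI → ℝ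
  θ : ℕ → ℝ
  α : ℕ → ℝ

/-- The line search criterion in iteration `k`, for the trial step size `a`. -/
def LineSearchCond {X ιE ιI : Type*} [NormedAddCommGroup X] [InnerProductSpace ℝ X]
    [CompleteSpace X] [Fintype ιE] [Fintype ιI] (P : Problem X ιE ιI) (η : ℝ)
    (s : SQPSequences X ιE ιI) (k : ℕ) (a : ℝ) : Prop :=
  η * a * (1 / 2 * inner ℝ (s.d k) (s.B k (s.d k))) ≤
    P.merit (s.x k) (s.θ k) - P.merit (s.x k + a • s.d k) (s.θ k)

/-- `s` is an infinite run of the line search SQP method with line search coefficient `η`,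
backtracking factor `τ` and penalty increment `γ`.  The rule by which `B` is updated is free. -/
structure IsSQPRun {X ιE ιI : Type*} [NormedAddCommGroup X] [InnerProductSpace ℝ X]
    [CompleteSpace X] [Fintype ιE] [Fintype ιI] (P : Problem X ιE ιI) (η τ γ : ℝ)
    (s : SQPSequences X ιE ιI) : Prop where
  theta_zero_pos : 0 < s.θ 0
  subgradient : ∀ k, s.g k ∈ clarkeSubdiff P.f (s.x k)
  solution : ∀ k,
    P.IsSubSolution (s.x k) (s.g k) (s.B k) (s.θ k) (s.d k) (s.v k) (s.w k) (s.t k)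
  multiplier : ∀ k, P.IsSubMultiplier (s.x k) (s.g k) (s.B k) (s.θ k) (s.d k) (s.v k) (s.w k)
    (s.t k) (s.lamE k) (s.lamI k)
  theta_succ : ∀ k, s.θ (k + 1) = max (s.θ k) (max ‖s.lamE k‖ ‖s.lamI k‖ + γ)
  backtracking : ∀ k, ∃ j : ℕ, s.α k = τ ^ j ∧ LineSearchCond P η s k (τ ^ j) ∧
    ∀ i < j, ¬ LineSearchCond P η s k (τ ^ i)
  step : ∀ k, s.x (k + 1) = s.x k + s.α k • s.d k

end

end NonsmoothSQP

/-! Every Clarke subgradient `g` of the upper-C² function `f` at `x ∈ D` yields f(y) ≤ f(x) + ⟨g, y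
- x⟩ + (ρ/2)‖y - x‖² on `D` (`UpperC2On.le_quadratic`). Optimality in the subproblem says that -(g +
B d) is a subgradient of θ·violation at x + d (`Problem.IsSubMultiplier.le_inner`). Both facts
together with ρ ≤ b make the full step pass the line search.

The penalty parameters stay bounded: otherwise the violation tends to 0, and the normalized
multipliers accumulate at a nonzero vector that the Mangasarian-Fromovitz condition excludes. Hence
θ converges, the increment γ eventually keeps the multipliers strictly below θ, the slacks vanish
and the iterates are feasible.

On the feasible tail, put z_k = (x_{k+1}, σ x_k - g_k, x_k). There the potential equals ℓ_k = f(x_k)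
+ ⟨g_k, d_k⟩ + ((σ + l)/2)‖d_k‖², and f(x_{k+1}) + (l/2)‖d_k‖² ≤ ℓ_k ≤ f(x_k), where the upper bound
uses σ + l ≤ 2b. So ℓ decreases by at least (l/2)‖d_k‖² per step. The potential has a subgradient of
size O(‖d_k‖) at z_k, so the KL inequality with exponent at most 1/2 gives ℓ_k - lim ℓ ≤ M‖d_k‖².
Decrease and gap bound together make the gap contract geometrically, hence also ‖d_k‖, and the steps
are summable. -/

namespace NonsmoothSQP

/-! ### Clarke subgradients of upper-C² and Lipschitz functions. -/

section Clarke

variable {X : Type*} [NormedAddCommGroup X] [InnerProductSpace ℝ X]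

/-- Some active function of an upper-`C²` representation has directional derivative at most
`⟪g, v⟫ + ε`, for every Clarke subgradient `g`. -/
theorem UpperC2On.exists_active_of_mem_clarkeSubdiff {f : X → ℝ} {x g : X}
    (hfx : ContinuousAt f x) (hg : g ∈ clarkeSubdiff f x) {V : Set X} (hV : IsOpen V) (hxV : x ∈ V)
    {T : Type*} [TopologicalSpace T] [CompactSpace T] {p : T → X → ℝ}
    (hp : ∀ t, ContDiffOn ℝ 2 (p t) V)
    (hcont : ∀ j : ℕ, j ≤ 2 →
      ContinuousOn (fun q : T × X => iteratedFDeriv ℝ j (p q.1) q.2) (univ ×ˢ V))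
    (hleast : ∀ y ∈ V, IsLeast (range fun t => p t y) (f y)) (v : X) {ε : ℝ} (hε : 0 < ε) :
    ∃ t, p t x = f x ∧ fderiv ℝ (p t) x v < inner ℝ g v + ε := by
  by_contra! hcon
  have hVn : ∀ t, (univ ×ˢ V : Set (T × X)) ∈ 𝓝 (t, x) := fun t =>
    prod_mem_nhds univ_mem (hV.mem_nhds hxV)
  have hc0 : ∀ t, ContinuousAt (fun q : T × X => p q.1 q.2) (t, x) := by
    intro t
    have h := (hcont 0 (by norm_num)).continuousAt (hVn t)
    have h2 := ((ContinuousMultilinearMap.apply ℝ (fun _ : Fin 0 => X) ℝ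
      (0 : Fin 0 → X)).continuous.continuousAt).comp h
    simpa [Function.comp_def] using h2
  have hc1 : ∀ t, ContinuousAt (fun q : T × X => fderiv ℝ (p q.1) q.2 v) (t, x) := by
    intro t
    have h := (hcont 1 (by norm_num)).continuousAt (hVn t)
    have h2 := ((ContinuousMultilinearMap.apply ℝ (fun _ : Fin 1 => X) ℝ
      (fun _ => v)).continuous.continuousAt).comp h
    simpa [Function.comp_def, iteratedFDeriv_one_apply] using h2
  -- Activity and derivative are taken at two independent points because the mean value theorem
  -- below moves the derivative to an intermediate point. Indices inactive at `x` stay inactive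
  -- nearby, and compactness of `T` makes the neighbourhood uniform in `t`.
  have hev : ∀ᶠ z : X × X in 𝓝 (x, x), ∀ t ∈ (univ : Set T),
      p t z.1 = f z.1 → inner ℝ g v + ε / 2 < fderiv ℝ (p t) z.2 v := by
    refine isCompact_univ.eventually_forall_of_forall_eventually ?_
    intro t _
    by_cases ht : p t x = f x
    · have h1 := hcon t ht
      have h2 : ContinuousAt (fun z : (X × X) × T => fderiv ℝ (p z.2) z.1.2 v) ((x, x), t) :=
        ContinuousAt.comp (f := fun z : (X × X) × T => (z.2, z.1.2))
          (g := fun q : T × X => fderiv ℝ (p q.1) q.2 v) (hc1 t) (by fun_prop)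
      have h3 : inner ℝ g v + ε / 2 < fderiv ℝ (p t) x v := by linarith
      filter_upwards [h2.eventually (lt_mem_nhds h3)] with z hz _ using hz
    · have h1 : f x < p t x := lt_of_le_of_ne ((hleast x hxV).2 ⟨t, rfl⟩) (Ne.symm ht)
      have h2 : ContinuousAt (fun z : (X × X) × T => p z.2 z.1.1 - f z.1.1) ((x, x), t) := by
        refine ContinuousAt.sub ?_ ?_
        · exact ContinuousAt.comp (f := fun z : (X × X) × T => (z.2, z.1.1))
            (g := fun q : T × X => p q.1 q.2) (hc0 t) (by fun_prop)
        · exact ContinuousAt.comp (f := fun z : (X × X) × T => z.1.1) (g := f) hfx (by fun_prop)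
      have h3 : (0 : ℝ) < p t x - f x := by linarith
      filter_upwards [h2.eventually (lt_mem_nhds h3)] with z hz hz'
      linarith
  obtain ⟨r, hr, hball⟩ := Metric.eventually_nhds_iff_ball.1
    (hev.and ((hV.prod hV).mem_nhds ⟨hxV, hxV⟩))
  have hball' : ∀ y ∈ Metric.ball x r, ∀ ξ ∈ Metric.ball x r, (y ∈ V ∧ ξ ∈ V) ∧
      ∀ t, p t y = f y → inner ℝ g v + ε / 2 < fderiv ℝ (p t) ξ v := by
    intro y hy ξ hξ
    have := hball (y, ξ) (by rw [← ball_prod_same]; exact ⟨hy, hξ⟩)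
    exact ⟨this.2, fun t => this.1 t (mem_univ _)⟩
  -- In the direction -v, an index active at the base point bounds the increment of `f` from above
  -- by that of a C² function. This forces the Clarke derivative below ⟨g, -v⟩.
  have hquot : ∀ᶠ q : X × ℝ in 𝓝 x ×ˢ 𝓝[>] (0 : ℝ),
      (((f (q.1 + q.2 • (-v)) - f q.1) / q.2 : ℝ) : EReal) ≤
        ((-(inner ℝ g v + ε / 2) : ℝ) : EReal) := by
    have e1 : ∀ᶠ q : X × ℝ in 𝓝 x ×ˢ 𝓝[>] (0 : ℝ), q.1 ∈ Metric.ball x r :=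
      tendsto_fst.eventually (Metric.ball_mem_nhds x hr)
    have e2 : ∀ᶠ q : X × ℝ in 𝓝 x ×ˢ 𝓝[>] (0 : ℝ), 0 < q.2 :=
      tendsto_snd.eventually self_mem_nhdsWithin
    have e3 : ∀ᶠ q : X × ℝ in 𝓝 x ×ˢ 𝓝[>] (0 : ℝ), q.1 + q.2 • (-v) ∈ Metric.ball x r := by
      have hc : Tendsto (fun q : X × ℝ => q.1 + q.2 • (-v)) (𝓝 (x, 0)) (𝓝 (x + (0 : ℝ) • (-v))) :=
        Continuous.tendsto (by fun_prop) _
      rw [zero_smul, add_zero] at hc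
      have hle : 𝓝 x ×ˢ 𝓝[>] (0 : ℝ) ≤ 𝓝 (x, (0 : ℝ)) := by
        rw [nhds_prod_eq]
        exact Filter.prod_mono le_rfl nhdsWithin_le_nhds
      exact (hc.mono_left hle).eventually (Metric.ball_mem_nhds x hr)
    filter_upwards [e1, e2, e3] with q h1 h2 h3
    obtain ⟨y, s⟩ := q
    simp only at h1 h2 h3 ⊢
    rw [EReal.coe_le_coe_iff, div_le_iff₀ h2]
    obtain ⟨⟨hyV, -⟩, -⟩ := hball' y h1 y h1
    obtain ⟨⟨-, hzV⟩, -⟩ := hball' y h1 _ h3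
    obtain ⟨t, ht⟩ := (hleast y hyV).1
    simp only at ht
    have hz : f (y + s • (-v)) ≤ p t (y + s • (-v)) := (hleast _ hzV).2 ⟨t, rfl⟩
    obtain ⟨ξ, hξ, hmv⟩ := domain_mvt (f := p t) (f' := fderiv ℝ (p t))
      (s := Metric.ball x r) (x := y + s • (-v)) (y := y)
      (fun w hw => (((hp t).differentiableOn (by norm_num)).differentiableAt
        (hV.mem_nhds (hball' w hw w hw).1.1)).hasFDerivAt.hasFDerivWithinAt)
      (convex_ball x r) h3 h1
    have hξ' : ξ ∈ Metric.ball x r := (convex_ball x r).segment_subset h3 h1 hξ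
    have h4 := (hball' y h1 ξ hξ').2 t ht
    have h5 : y - (y + s • (-v)) = s • v := by simp
    rw [h5, map_smul, smul_eq_mul] at hmv
    nlinarith
  have hle : clarkeDeriv f x (-v) ≤ ((-(inner ℝ g v + ε / 2) : ℝ) : EReal) :=
    limsup_le_of_le (h := hquot)
  have := (hg (-v)).trans hle
  rw [EReal.coe_le_coe_iff, inner_neg_right] at this
  linarith

/-- An active `p t` majorizes `f` and touches it at `x`, so its one-sided difference quotient bounds
that of `f`. -/
theorem UpperC2On.eventually_le_of_mem_clarkeSubdiff {f : X → ℝ} {O : Set X} {x g : X}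
    (hf : UpperC2On f O) (hx : x ∈ O) (hfx : ContinuousAt f x) (hg : g ∈ clarkeSubdiff f x)
    (v : X) {ε : ℝ} (hε : 0 < ε) :
    ∀ᶠ s in 𝓝[>] (0 : ℝ), f (x + s • v) ≤ f x + s * (inner ℝ g v + ε) := by
  obtain ⟨V, hV, hxV, T, _, _, p, hp, hcont, hleast⟩ := hf x hx
  obtain ⟨t, ht, htv⟩ :=
    UpperC2On.exists_active_of_mem_clarkeSubdiff hfx hg hV hxV hp hcont hleast v hε
  have hline : HasDerivAt (fun s : ℝ => x + s • v) v 0 := by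
    simpa using ((hasDerivAt_id (0 : ℝ)).smul_const v).const_add x
  have hd : HasFDerivAt (p t) (fderiv ℝ (p t) x) (x + (0 : ℝ) • v) := by
    rw [zero_smul, add_zero]
    exact (((hp t).differentiableOn (by norm_num)).differentiableAt
        (hV.mem_nhds hxV)).hasFDerivAt
  have hslope := (hd.comp_hasDerivAt (0 : ℝ) hline).tendsto_slope_zero_right
  have hVev : ∀ᶠ s in 𝓝[>] (0 : ℝ), x + s • v ∈ V := by
    have hc : Tendsto (fun s : ℝ => x + s • v) (𝓝[>] 0) (𝓝 (x + (0 : ℝ) • v)) :=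
      (Continuous.tendsto (by fun_prop) _).mono_left nhdsWithin_le_nhds
    rw [zero_smul, add_zero] at hc
    exact hc.eventually (hV.mem_nhds hxV)
  filter_upwards [hslope.eventually (gt_mem_nhds htv), hVev, self_mem_nhdsWithin] with s h1 h2 h3
  have h3' : (0 : ℝ) < s := h3
  simp only [Function.comp_def, zero_add, zero_smul, add_zero, smul_eq_mul, ht] at h1
  have h4 : f (x + s • v) ≤ p t (x + s • v) := (hleast _ h2).2 ⟨t, rfl⟩
  have h5 : p t (x + s • v) - f x = s * (s⁻¹ * (p t (x + s • v) - f x)) := by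
    field_simp
  have h6 := mul_lt_mul_of_pos_left h1 h3'
  linarith

/-- If `-f + (ρ/2) ‖·‖²` is convex on `D`, then `σ x - g` is a subgradient of
`-f + (σ/2) ‖·‖²` relative to `D` for `σ ≥ ρ`, in the form of a quadratic upper bound of `f`. -/
theorem UpperC2On.le_quadratic {f : X → ℝ} {O D : Set X} {x y g : X} {ρ : ℝ}
    (hf : UpperC2On f O) (hx : x ∈ O) (hfx : ContinuousAt f x) (hg : g ∈ clarkeSubdiff f x)
    (hconv : ConvexOn ℝ D (fun x => -f x + ρ / 2 * ‖x‖ ^ 2)) (hxD : x ∈ D) (hyD : y ∈ D) :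
    f y ≤ f x + inner ℝ g (y - x) + ρ / 2 * ‖y - x‖ ^ 2 := by
  -- Convexity is applied at x + s(y - x), where `f` is controlled to first order; dividing by s
  -- leaves the factor 1 - s on the quadratic term, which disappears as s ↓ 0.
  refine le_of_forall_pos_le_add fun ε hε => ?_
  have hlim : Tendsto (fun s : ℝ => f x + (inner ℝ g (y - x) + ε) + (1 - s) * (ρ / 2 * ‖y - x‖ ^ 2))
      (𝓝[>] 0) (𝓝 (f x + (inner ℝ g (y - x) + ε) + (1 - 0) * (ρ / 2 * ‖y - x‖ ^ 2))) :=
    (Continuous.tendsto (by fun_prop) _).mono_left nhdsWithin_le_nhds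
  have hev : ∀ᶠ s in 𝓝[>] (0 : ℝ),
      f y ≤ f x + (inner ℝ g (y - x) + ε) + (1 - s) * (ρ / 2 * ‖y - x‖ ^ 2) := by
    have h1 : ∀ᶠ s in 𝓝[>] (0 : ℝ), s < 1 :=
      nhdsWithin_le_nhds (gt_mem_nhds one_pos)
    filter_upwards [hf.eventually_le_of_mem_clarkeSubdiff hx hfx hg (y - x) hε,
      self_mem_nhdsWithin, h1] with s h2 h3 h4
    have h3' : (0 : ℝ) < s := h3
    have h5 := hconv.2 hxD hyD (by linarith : (0 : ℝ) ≤ 1 - s) h3'.le (by ring)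
    have h6 : (1 - s) • x + s • y = x + s • (y - x) := by
      rw [sub_smul, one_smul, smul_sub]; abel
    rw [h6] at h5
    simp only [smul_eq_mul] at h5
    have h7 : ‖x + s • (y - x)‖ ^ 2 = ‖x‖ ^ 2 + 2 * s * inner ℝ x (y - x) + s ^ 2 * ‖y - x‖ ^ 2 := by
      rw [norm_add_sq_real, inner_smul_right, norm_smul, mul_pow, Real.norm_eq_abs, sq_abs]; ring
    have h8 : ‖y‖ ^ 2 = ‖x‖ ^ 2 + 2 * inner ℝ x (y - x) + ‖y - x‖ ^ 2 := by
      conv_lhs => rw [← add_sub_cancel x y]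
      rw [norm_add_sq_real]
    rw [h7, h8] at h5
    refine le_of_mul_le_mul_left ?_ h3'
    nlinarith
  have := ge_of_tendsto hlim hev
  linarith

/-- Testing with the direction `g` itself gives ‖g‖² ≤ K‖g‖. -/
theorem norm_le_of_mem_clarkeSubdiff {f : X → ℝ} {O : Set X} {K : NNReal} {x g : X}
    (hO : O ∈ 𝓝 x) (hf : LipschitzOnWith K f O) (hg : g ∈ clarkeSubdiff f x) : ‖g‖ ≤ K := by
  have hle : clarkeDeriv f x g ≤ ((K * ‖g‖ : ℝ) : EReal) := by
    refine limsup_le_of_le (h := ?_)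
    have e1 : ∀ᶠ q : X × ℝ in 𝓝 x ×ˢ 𝓝[>] (0 : ℝ), q.1 ∈ O := tendsto_fst.eventually hO
    have e2 : ∀ᶠ q : X × ℝ in 𝓝 x ×ˢ 𝓝[>] (0 : ℝ), 0 < q.2 :=
      tendsto_snd.eventually self_mem_nhdsWithin
    have e3 : ∀ᶠ q : X × ℝ in 𝓝 x ×ˢ 𝓝[>] (0 : ℝ), q.1 + q.2 • g ∈ O := by
      have hc : Tendsto (fun q : X × ℝ => q.1 + q.2 • g) (𝓝 (x, 0)) (𝓝 (x + (0 : ℝ) • g)) :=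
        Continuous.tendsto (by fun_prop) _
      rw [zero_smul, add_zero] at hc
      have hle : 𝓝 x ×ˢ 𝓝[>] (0 : ℝ) ≤ 𝓝 (x, (0 : ℝ)) := by
        rw [nhds_prod_eq]
        exact Filter.prod_mono le_rfl nhdsWithin_le_nhds
      exact (hc.mono_left hle).eventually hO
    filter_upwards [e1, e2, e3] with q h1 h2 h3
    rw [EReal.coe_le_coe_iff, div_le_iff₀ h2]
    have h4 := hf.dist_le_mul _ h3 _ h1
    rw [Real.dist_eq, dist_eq_norm, add_sub_cancel_left, norm_smul, Real.norm_eq_abs,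
      abs_of_pos h2] at h4
    linarith [le_abs_self (f (q.1 + q.2 • g) - f q.1)]
  have := (hg g).trans hle
  rw [EReal.coe_le_coe_iff, real_inner_self_eq_norm_sq, sq] at this
  by_contra! h
  have h0 : 0 < ‖g‖ := lt_of_le_of_lt K.2 h
  nlinarith

end Clarke

/-- `aE` and `aI` are the constant gradients of the constraint functions, which are affine. -/
structure Problem.HasNormals {X ιE ιI : Type*} [NormedAddCommGroup X] [InnerProductSpace ℝ X]
    [CompleteSpace X] (P : Problem X ιE ιI) (aE : ιE → X) (aI : ιI → X) : Prop where
  gradE : ∀ i x, gradient (P.cE i) x = aE i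
  gradI : ∀ i x, gradient (P.cI i) x = aI i
  affE : ∀ i x y, P.cE i y = P.cE i x + inner ℝ (aE i) (y - x)
  affI : ∀ i x y, P.cI i y = P.cI i x + inner ℝ (aI i) (y - x)

theorem Problem.violation_nonneg {X ιE ιI : Type*} [Fintype ιE] [Fintype ιI] (P : Problem X ιE ιI) (x : X) :
    0 ≤ P.violation x :=
  add_nonneg (Finset.sum_nonneg fun _ _ => abs_nonneg _)
    (Finset.sum_nonneg fun _ _ => le_max_left _ _)

theorem Problem.violation_eq_zero_iff {X ιE ιI : Type*} [Fintype ιE] [Fintype ιI] (P : Problem X ιE ιI) {x : X} :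
    P.violation x = 0 ↔ x ∈ P.feasible := by
  unfold Problem.violation Problem.feasible
  rw [add_eq_zero_iff_of_nonneg (Finset.sum_nonneg fun _ _ => abs_nonneg _)
    (Finset.sum_nonneg fun _ _ => le_max_left _ _),
    Finset.sum_eq_zero_iff_of_nonneg (fun _ _ => abs_nonneg _),
    Finset.sum_eq_zero_iff_of_nonneg (fun _ _ => le_max_left _ _)]
  simp

/-! ### Optimality conditions of the subproblem, and multipliers under MFCQ. -/

section Subproblem

variable {X ιE ιI : Type*} [NormedAddCommGroup X] [InnerProductSpace ℝ X]

theorem exists_gradient_eq_of_affine [FiniteDimensional ℝ X] [CompleteSpace X]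
    (A : X →ᵃ[ℝ] ℝ) :
    ∃ a : X, (∀ x, gradient (A : X → ℝ) x = a) ∧ ∀ x y, A y = A x + inner ℝ a (y - x) := by
  let ℓ : X →L[ℝ] ℝ := LinearMap.toContinuousLinearMap A.linear
  have hA : ∀ x y, A y = A x + ℓ (y - x) := by
    intro x y
    have := A.linearMap_vsub y x
    simp only [vsub_eq_sub] at this
    change A y = A x + A.linear (y - x)
    rw [this]; ring
  refine ⟨(InnerProductSpace.toDual ℝ X).symm ℓ, fun x => ?_, fun x y => ?_⟩
  · have h : HasFDerivAt (A : X → ℝ) ℓ x := by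
      have h1 : (A : X → ℝ) = fun y => A 0 + ℓ y := by
        funext y; rw [hA 0 y, sub_zero]
      rw [h1]
      exact ℓ.hasFDerivAt.const_add _
    rw [gradient, h.fderiv]
  · rw [InnerProductSpace.toDual_symm_apply]; exact hA x y

theorem Problem.AffineConstraints.exists_hasNormals [FiniteDimensional ℝ X] [CompleteSpace X]
    {P : Problem X ιE ιI} (h : P.AffineConstraints) : ∃ aE aI, P.HasNormals aE aI := by
  choose AE hAE using h.1
  choose AI hAI using h.2
  choose aE h1 h2 using fun i => exists_gradient_eq_of_affine (AE i)
  choose aI h3 h4 using fun i => exists_gradient_eq_of_affine (AI i)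
  exact ⟨aE, aI, fun i => by rw [hAE i]; exact h1 i, fun i => by rw [hAI i]; exact h3 i,
    fun i => by rw [hAE i]; exact h2 i, fun i => by rw [hAI i]; exact h4 i⟩

variable [CompleteSpace X] {P : Problem X ιE ιI} {aE : ιE → X} {aI : ιI → X}

theorem Problem.HasNormals.continuous_violation [Fintype ιE] [Fintype ιI]
    (hP : P.HasNormals aE aI) : Continuous P.violation := by
  have hE : ∀ i, Continuous (P.cE i) := fun i => by
    rw [show P.cE i = fun y => P.cE i 0 + inner ℝ (aE i) (y - 0) from
      funext fun y => hP.affE i 0 y]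
    fun_prop
  have hI : ∀ i, Continuous (P.cI i) := fun i => by
    rw [show P.cI i = fun y => P.cI i 0 + inner ℝ (aI i) (y - 0) from
      funext fun y => hP.affI i 0 y]
    fun_prop
  unfold Problem.violation
  fun_prop

section

variable [Fintype ιE] [Fintype ιI] {x g d : X} {B : X →L[ℝ] X} {θ : ℝ} {v w : ιE → ℝ} {t : ιI → ℝ}
  {lamE : ιE → ℝ} {lamI : ιI → ℝ}

theorem Problem.IsSubMultiplier.abs_lamE_le
    (hm : P.IsSubMultiplier x g B θ d v w t lamE lamI) (i : ιE) : |lamE i| ≤ θ := by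
  obtain ⟨-, -, -, p, q, r, hp, hq, -, hp', hq', -⟩ := hm
  rw [abs_le]
  constructor <;> linarith [hp i, hq i, hp' i, hq' i]

theorem Problem.IsSubMultiplier.lamI_le
    (hm : P.IsSubMultiplier x g B θ d v w t lamE lamI) (i : ιI) : lamI i ≤ θ := by
  obtain ⟨-, -, -, p, q, r, -, -, hr, -, -, hr', -⟩ := hm
  linarith [hr i, hr' i]

/-- Complementarity of the slack bounds turns the left side into -θ(v_i + w_i), and v_i + w_i ≥ |v_i
- w_i|. Together with |λ_i| ≤ θ this makes -λ_i a subgradient of θ|·| at c_i(x + d). -/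
theorem Problem.IsSubMultiplier.lamE_mul_le (hP : P.HasNormals aE aI)
    (hm : P.IsSubMultiplier x g B θ d v w t lamE lamI) (hs : P.SubFeasible x d v w t) (i : ιE) :
    lamE i * P.cE i (x + d) ≤ -(θ * |P.cE i (x + d)|) := by
  have hθ : 0 ≤ θ := (abs_nonneg _).trans (hm.abs_lamE_le i)
  obtain ⟨-, -, -, p, q, r, hp, hq, -, hp', hq', -, hpv, hqw, -⟩ := hm
  obtain ⟨h1, -, hv, hw, -⟩ := hs
  have h2 : P.cE i (x + d) = v i - w i := by
    rw [← h1 i, hP.gradE, hP.affE i x (x + d), add_sub_cancel_left]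
  have h3 : |P.cE i (x + d)| ≤ v i + w i := by
    rw [h2, abs_le]
    constructor <;> linarith [hv i, hw i]
  have h4 : (θ + lamE i) * v i = 0 := by
    rw [← hpv i]; congr 1; linarith [hp' i]
  have h5 : (θ - lamE i) * w i = 0 := by
    rw [← hqw i]; congr 1; linarith [hq' i]
  have h6 := mul_le_mul_of_nonneg_left h3 hθ
  have h7 : lamE i * P.cE i (x + d) = -(θ * (v i + w i)) := by
    rw [h2]; linear_combination h4 + h5
  linarith

theorem Problem.IsSubMultiplier.lamI_mul_le (hP : P.HasNormals aE aI)
    (hm : P.IsSubMultiplier x g B θ d v w t lamE lamI) (hs : P.SubFeasible x d v w t) (i : ιI) :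
    lamI i * P.cI i (x + d) ≤ -(θ * max 0 (-P.cI i (x + d))) := by
  have hθ : 0 ≤ θ := (hm.2.1 i).trans (hm.lamI_le i)
  obtain ⟨-, -, hc, p, q, r, -, -, hr, -, -, hr', -, -, hrt⟩ := hm
  obtain ⟨-, h1, -, -, ht⟩ := hs
  have h2 : P.cI i (x + d) = P.cI i x + inner ℝ (gradient (P.cI i) x) d := by
    rw [hP.gradI, hP.affI i x (x + d), add_sub_cancel_left]
  have h1' := h1 i
  have hc' := hc i
  rw [← h2] at h1' hc'
  have h3 : max 0 (-P.cI i (x + d)) ≤ t i := max_le (ht i) (by linarith)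
  have h4 : (θ - lamI i) * t i = 0 := by
    rw [← hrt i]; congr 1; linarith [hr' i]
  have h6 := mul_le_mul_of_nonneg_left h3 hθ
  have h7 : lamI i * P.cI i (x + d) = -(θ * t i) := by linear_combination hc' + h4
  linarith

/-- Optimality of `d` for the exact penalty form of the quadratic subproblem, as a variational
inequality. -/
theorem Problem.IsSubMultiplier.le_inner (hP : P.HasNormals aE aI)
    (hm : P.IsSubMultiplier x g B θ d v w t lamE lamI) (hs : P.SubFeasible x d v w t) (z : X) :
    θ * P.violation (x + d) - θ * P.violation z ≤ inner ℝ (g + B d) (z - (x + d)) := by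
  have hkkt : g + B d = ∑ i, lamE i • aE i + ∑ i, lamI i • aI i := by
    have := hm.1
    simp only [hP.gradE, hP.gradI] at this
    exact sub_eq_zero.1 this
  have hE : ∀ i, θ * |P.cE i (x + d)| - θ * |P.cE i z| ≤
      lamE i * inner ℝ (aE i) (z - (x + d)) := by
    intro i
    have h1 := hm.lamE_mul_le hP hs i
    have h2 := hP.affE i (x + d) z
    have h3 : -(lamE i * P.cE i z) ≤ θ * |P.cE i z| :=
      (neg_le_abs _).trans (by
        rw [abs_mul]
        exact mul_le_mul_of_nonneg_right (hm.abs_lamE_le i) (abs_nonneg _))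
    have h4 : inner ℝ (aE i) (z - (x + d)) = P.cE i z - P.cE i (x + d) := by linarith
    rw [h4]; linarith
  have hI : ∀ i, θ * max 0 (-P.cI i (x + d)) - θ * max 0 (-P.cI i z) ≤
      lamI i * inner ℝ (aI i) (z - (x + d)) := by
    intro i
    have h1 := hm.lamI_mul_le hP hs i
    have h2 := hP.affI i (x + d) z
    have h3 : lamI i * (-P.cI i z) ≤ θ * max 0 (-P.cI i z) :=
      (mul_le_mul_of_nonneg_left (le_max_right _ _) (hm.2.1 i)).trans
        (mul_le_mul_of_nonneg_right (hm.lamI_le i) (le_max_left _ _))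
    have h4 : inner ℝ (aI i) (z - (x + d)) = P.cI i z - P.cI i (x + d) := by linarith
    rw [h4]; linarith
  have e : inner ℝ (g + B d) (z - (x + d)) = ∑ i, lamE i * inner ℝ (aE i) (z - (x + d)) +
      ∑ i, lamI i * inner ℝ (aI i) (z - (x + d)) := by
    rw [hkkt, inner_add_left, sum_inner, sum_inner]
    simp only [real_inner_smul_left]
  rw [e]
  have sE := Finset.sum_le_sum fun i (_ : i ∈ Finset.univ) => hE i
  have sI := Finset.sum_le_sum fun i (_ : i ∈ Finset.univ) => hI i
  simp only [Finset.sum_sub_distrib, ← Finset.mul_sum] at sE sI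
  unfold Problem.violation
  linarith

/-- If the multipliers are smaller than the penalty parameter, all slacks vanish. -/
theorem Problem.IsSubMultiplier.add_mem_feasible (hP : P.HasNormals aE aI)
    (hm : P.IsSubMultiplier x g B θ d v w t lamE lamI) (hs : P.SubFeasible x d v w t)
    (hE : ‖lamE‖ < θ) (hI : ‖lamI‖ < θ) : x + d ∈ P.feasible := by
  constructor
  · intro i
    have h1 := hm.lamE_mul_le hP hs i
    have h2 : |lamE i| < θ := (norm_le_pi_norm lamE i).trans_lt hE
    have h3 := neg_abs_le (lamE i * P.cE i (x + d))
    rw [abs_mul] at h3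
    by_contra h
    have := mul_lt_mul_of_pos_right h2 (abs_pos.2 h)
    linarith
  · intro i
    have h1 := hm.lamI_mul_le hP hs i
    have h2 : lamI i < θ := (le_abs_self _).trans_lt ((norm_le_pi_norm lamI i).trans_lt hI)
    by_contra! h
    rw [max_eq_right (by linarith)] at h1
    nlinarith

end

/-- Under the Mangasarian-Fromovitz condition at the limit points, multipliers with bounded
residuals cannot tend to infinity while the constraint violation tends to zero. -/
theorem not_tendsto_multiplier_atTop [Fintype ιE] [Fintype ιI] (hP : P.HasNormals aE aI)
    {D : Set X} (hD : IsCompact D) {u : ℕ → X} (huD : ∀ k, u k ∈ D)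
    {lamE : ℕ → ιE → ℝ} {lamI : ℕ → ιI → ℝ} {R : ℝ}
    (hres : ∀ k, ‖∑ i, lamE k i • aE i + ∑ i, lamI k i • aI i‖ ≤ R)
    (hnonneg : ∀ k i, 0 ≤ lamI k i) (hcompl : ∀ k i, 0 < lamI k i → P.cI i (u k) ≤ 0)
    (hviol : Tendsto (fun k => P.violation (u k)) atTop (𝓝 0))
    (hMF : ∀ y, MapClusterPt y atTop u → P.MFCQ y) :
    ¬ Tendsto (fun k => max ‖lamE k‖ ‖lamI k‖) atTop atTop := by
  intro htend
  set N : ℕ → ℝ := fun k => max ‖lamE k‖ ‖lamI k‖ with hN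
  -- Normalized multipliers: of norm one once `N k` is positive, and zero in the degenerate case `N
  -- k = 0`, so they always lie in the unit ball.
  let μ : ℕ → (ιE → ℝ) × (ιI → ℝ) := fun k => (N k)⁻¹ • (lamE k, lamI k)
  have hNnn : ∀ k, 0 ≤ N k := fun k => (norm_nonneg _).trans (le_max_left _ _)
  have hμnorm : ∀ k, ‖μ k‖ = (N k)⁻¹ * N k := by
    intro k
    rw [norm_smul, norm_inv, Real.norm_eq_abs, abs_of_nonneg (hNnn k), Prod.norm_def]
  have hμ1 : ∀ k, μ k ∈ Metric.closedBall (0 : (ιE → ℝ) × (ιI → ℝ)) 1 := by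
    intro k
    rw [mem_closedBall_zero_iff, hμnorm]
    exact inv_mul_le_one
  obtain ⟨⟨y, μ'⟩, -, φ, hφ, hlim⟩ := (hD.prod (isCompact_closedBall
    (0 : (ιE → ℝ) × (ιI → ℝ)) 1)).tendsto_subseq (x := fun k => (u k, μ k))
    (fun k => ⟨huD k, hμ1 k⟩)
  have hu : Tendsto (fun k => u (φ k)) atTop (𝓝 y) := (continuous_fst.tendsto _).comp hlim
  have hμ : Tendsto (fun k => μ (φ k)) atTop (𝓝 μ') := (continuous_snd.tendsto _).comp hlim
  have hμE : ∀ i, Tendsto (fun k => (μ (φ k)).1 i) atTop (𝓝 (μ'.1 i)) := fun i =>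
    (Continuous.tendsto (by fun_prop : Continuous fun z : (ιE → ℝ) × (ιI → ℝ) => z.1 i) _).comp hμ
  have hμI : ∀ i, Tendsto (fun k => (μ (φ k)).2 i) atTop (𝓝 (μ'.2 i)) := fun i =>
    (Continuous.tendsto (by fun_prop : Continuous fun z : (ιE → ℝ) × (ιI → ℝ) => z.2 i) _).comp hμ
  have hNφ : Tendsto (fun k => N (φ k)) atTop atTop := htend.comp hφ.tendsto_atTop
  have hpos : ∀ᶠ k in atTop, 0 < N (φ k) := hNφ.eventually_gt_atTop 0
  have hnorm : ‖μ'‖ = 1 := by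
    refine tendsto_nhds_unique hμ.norm (tendsto_const_nhds.congr' ?_)
    filter_upwards [hpos] with k hk
    rw [hμnorm, inv_mul_cancel₀ hk.ne']
  have hzero : ∑ i, μ'.1 i • aE i + ∑ i, μ'.2 i • aI i = 0 := by
    have h1 : Tendsto (fun k => ∑ i, (μ (φ k)).1 i • aE i + ∑ i, (μ (φ k)).2 i • aI i) atTop
        (𝓝 (∑ i, μ'.1 i • aE i + ∑ i, μ'.2 i • aI i)) :=
      (tendsto_finsetSum _ fun i _ => (hμE i).smul_const _).add
        (tendsto_finsetSum _ fun i _ => (hμI i).smul_const _)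
    refine tendsto_nhds_unique h1 ?_
    have h2 : Tendsto (fun k => (N (φ k))⁻¹ * R) atTop (𝓝 0) := by
      simpa using (tendsto_inv_atTop_zero.comp hNφ).mul_const R
    refine squeeze_zero_norm (fun k => ?_) h2
    have e : ∑ i, (μ (φ k)).1 i • aE i + ∑ i, (μ (φ k)).2 i • aI i =
        (N (φ k))⁻¹ • (∑ i, lamE (φ k) i • aE i + ∑ i, lamI (φ k) i • aI i) := by
      simp only [μ, smul_add, Finset.smul_sum, smul_smul, Prod.smul_mk, Pi.smul_apply, smul_eq_mul]
    rw [e, norm_smul, norm_inv, Real.norm_eq_abs, abs_of_nonneg (hNnn _)]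
    exact mul_le_mul_of_nonneg_left (hres _) (inv_nonneg.2 (hNnn _))
  have hfeas : y ∈ P.feasible := by
    rw [← P.violation_eq_zero_iff]
    exact tendsto_nhds_unique ((hP.continuous_violation.tendsto y).comp hu)
      (hviol.comp hφ.tendsto_atTop)
  have hμInn : ∀ i, 0 ≤ μ'.2 i := fun i =>
    ge_of_tendsto' (hμI i) fun k => mul_nonneg (inv_nonneg.2 (hNnn _)) (hnonneg _ i)
  have hact : ∀ i, 0 < μ'.2 i → P.cI i y = 0 := by
    intro i hi
    refine le_antisymm ?_ (hfeas.2 i)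
    have hc : Tendsto (fun k => P.cI i (u (φ k))) atTop (𝓝 (P.cI i y)) := by
      have : Continuous (P.cI i) := by
        rw [show P.cI i = fun y => P.cI i 0 + inner ℝ (aI i) (y - 0) from
          funext fun y => hP.affI i 0 y]
        fun_prop
      exact (this.tendsto y).comp hu
    refine le_of_tendsto hc ?_
    filter_upwards [(hμI i).eventually (lt_mem_nhds hi)] with k hk
    refine hcompl _ _ (lt_of_le_of_ne (hnonneg _ i) fun h => ?_)
    simp only [μ, Prod.smul_mk, Pi.smul_apply, smul_eq_mul, ← h, mul_zero, lt_irrefl] at hk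
  -- Pairing the limit relation with the Mangasarian-Fromovitz direction kills the inequality part,
  -- and linear independence then kills the equality part, against the norm being one.
  obtain ⟨hli, w, hw, hw0⟩ := hMF y
    (MapClusterPt.of_comp hφ.tendsto_atTop hu.mapClusterPt)
  simp only [hP.gradE, hP.gradI] at hli hw hw0
  have hsum : ∑ i, μ'.2 i * inner ℝ (aI i) w = 0 := by
    have := congrArg (fun z => inner ℝ z w) hzero
    simpa [inner_add_left, sum_inner, real_inner_smul_left, hw0] using this
  have hterm : ∀ i, 0 ≤ μ'.2 i * inner ℝ (aI i) w := by
    intro i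
    rcases (hμInn i).eq_or_lt with h | h
    · rw [← h, zero_mul]
    · exact mul_nonneg h.le (hw i (hact i h)).le
  have hI0 : μ'.2 = 0 := by
    funext i
    have h1 := (Finset.sum_eq_zero_iff_of_nonneg fun i _ => hterm i).1 hsum i (Finset.mem_univ i)
    by_contra h
    have h2 : 0 < μ'.2 i := lt_of_le_of_ne (hμInn i) (Ne.symm h)
    exact (mul_pos h2 (hw i (hact i h2))).ne' h1
  have hE0 : μ'.1 = 0 := by
    rw [hI0] at hzero
    simp only [Pi.zero_apply, zero_smul, Finset.sum_const_zero, add_zero] at hzero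
    funext i
    exact Fintype.linearIndependent_iff.1 hli _ hzero i
  have : μ' = 0 := Prod.ext hE0 hI0
  rw [this, norm_zero] at hnorm
  exact zero_ne_one hnorm

end Subproblem

/-! ### Unit steps, bounded penalty parameters and eventual feasibility. -/

section Run

variable {X ιE ιI : Type*} [NormedAddCommGroup X] [InnerProductSpace ℝ X] [CompleteSpace X]
  [Fintype ιE] [Fintype ιI] {P : Problem X ιE ιI} {aE : ιE → X} {aI : ιI → X}
  {s : SQPSequences X ιE ιI} {η τ γ b ρ : ℝ}

theorem IsSQPRun.theta_mono (hrun : IsSQPRun P η τ γ s) : Monotone s.θ :=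
  monotone_nat_of_le_succ fun k => by rw [hrun.theta_succ]; exact le_max_left _ _

theorem IsSQPRun.theta_pos (hrun : IsSQPRun P η τ γ s) (k : ℕ) : 0 < s.θ k :=
  hrun.theta_zero_pos.trans_le (hrun.theta_mono (Nat.zero_le k))

/-- If the quadratic terms dominate the weak concavity constant, unit steps are accepted. -/
theorem IsSQPRun.x_succ (hP : P.HasNormals aE aI) (hrun : IsSQPRun P η τ γ s) (hη : η ≤ 1)
    (hb : 0 < b) (hρb : ρ ≤ b) (hB_pos : ∀ k d, b * ‖d‖ ^ 2 ≤ inner ℝ d (s.B k d))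
    (hf : ∀ k, P.f (s.x k + s.d k) ≤
      P.f (s.x k) + inner ℝ (s.g k) (s.d k) + ρ / 2 * ‖s.d k‖ ^ 2) (k : ℕ) :
    s.x (k + 1) = s.x k + s.d k := by
  obtain ⟨j, hj, -, hmin⟩ := hrun.backtracking k
  -- The merit decrease is at least dᵀBd - (ρ/2)‖d‖², and ρ‖d‖² ≤ b‖d‖² ≤ dᵀBd leaves at least half
  -- of dᵀBd.
  have hcond : LineSearchCond P η s k (τ ^ 0) := by
    unfold LineSearchCond Problem.merit
    have h1 := (hrun.multiplier k).le_inner hP (hrun.solution k).1 (s.x k)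
    rw [sub_add_cancel_left, inner_neg_right, inner_add_left,
      real_inner_comm (s.d k) (s.B k (s.d k))] at h1
    have h2 := hf k
    have h3 := hB_pos k (s.d k)
    have h4 : 0 ≤ ‖s.d k‖ ^ 2 := sq_nonneg _
    have h5 := mul_le_mul_of_nonneg_right hρb h4
    have h6 : 0 ≤ inner ℝ (s.d k) (s.B k (s.d k)) := (mul_nonneg hb.le h4).trans h3
    have h7 := mul_le_mul_of_nonneg_right hη h6
    rw [pow_zero, one_smul]
    linarith
  have hj0 : j = 0 := by
    by_contra h
    exact hmin 0 (Nat.pos_of_ne_zero h) hcond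
  rw [hrun.step k, hj, hj0, pow_zero, one_smul]

/-- The penalty parameters are bounded. -/
theorem IsSQPRun.exists_theta_le (hP : P.HasNormals aE aI) (hrun : IsSQPRun P η τ γ s)
    {D : Set X} (hD : IsCompact D) (hxD : ∀ k, s.x k ∈ D) (hne : P.feasible.Nonempty)
    (hx : ∀ k, s.x (k + 1) = s.x k + s.d k) {R : ℝ} (hR : ∀ k, ‖s.g k + s.B k (s.d k)‖ ≤ R)
    (hMFCQ : ∀ y, MapClusterPt y atTop s.x → P.MFCQ y) : ∃ Θ, ∀ k, s.θ k ≤ Θ := by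
  by_contra! hcon
  have hθ : Tendsto s.θ atTop atTop := by
    refine tendsto_atTop_atTop.2 fun c => ?_
    obtain ⟨k, hk⟩ := hcon c
    exact ⟨k, fun j hj => hk.le.trans (hrun.theta_mono hj)⟩
  obtain ⟨z, hz⟩ := hne
  obtain ⟨C, hC⟩ := hD.isBounded.exists_norm_le
  have hR0 : 0 ≤ R := (norm_nonneg _).trans (hR 0)
  -- Comparison with a fixed feasible `z` bounds θ_k times the violation at x_{k+1} uniformly in k.
  have hviol : Tendsto (fun k => P.violation (s.x (k + 1))) atTop (𝓝 0) := by
    have h1 : Tendsto (fun k => (s.θ k)⁻¹ * (R * (‖z‖ + C))) atTop (𝓝 0) := by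
      simpa using (tendsto_inv_atTop_zero.comp hθ).mul_const (R * (‖z‖ + C))
    refine squeeze_zero (fun k => P.violation_nonneg _) (fun k => ?_) h1
    have h2 := (hrun.multiplier k).le_inner hP (hrun.solution k).1 z
    rw [P.violation_eq_zero_iff.2 hz, ← hx, mul_zero, sub_zero] at h2
    rw [le_inv_mul_iff₀ (hrun.theta_pos k)]
    refine h2.trans ((real_inner_le_norm _ _).trans ?_)
    refine mul_le_mul (hR k) ?_ (norm_nonneg _) hR0
    exact (norm_sub_le _ _).trans (by linarith [hC _ (hxD (k + 1))])
  have hfreq : ∃ᶠ k in atTop, s.θ k < s.θ (k + 1) := by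
    rw [frequently_atTop]
    intro N
    by_contra! h
    obtain ⟨k, hk⟩ := hcon (s.θ N)
    have hconst : ∀ j, s.θ (N + j) ≤ s.θ N := by
      intro j
      induction j with
      | zero => exact le_rfl
      | succ j ih => exact (h (N + j) (by omega)).trans ih
    have := hrun.theta_mono (show k ≤ N + k by omega)
    linarith [hconst k]
  obtain ⟨κ, hκ, hκ'⟩ := extraction_of_frequently_atTop hfreq
  -- At an index where θ strictly increases, the maximum in the update is attained by the multiplier
  -- term.
  have hlam : ∀ k, max ‖s.lamE (κ k)‖ ‖s.lamI (κ k)‖ = s.θ (κ k + 1) - γ := by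
    intro k
    have h1 := hrun.theta_succ (κ k)
    have h2 := hκ' k
    rcases max_choice (s.θ (κ k)) (max ‖s.lamE (κ k)‖ ‖s.lamI (κ k)‖ + γ) with h | h
    · rw [h] at h1; linarith
    · rw [h] at h1; linarith
  have hκ1 : Tendsto (fun k => κ k + 1) atTop atTop :=
    tendsto_atTop_mono (fun k => Nat.le_succ _) hκ.tendsto_atTop
  refine not_tendsto_multiplier_atTop hP hD (u := fun k => s.x (κ k + 1)) (fun k => hxD _)
    (lamE := fun k => s.lamE (κ k)) (lamI := fun k => s.lamI (κ k)) (R := R) (fun k => ?_)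
    (fun k i => (hrun.multiplier (κ k)).2.1 i) (fun k i hi => ?_)
    (hviol.comp hκ.tendsto_atTop)
    (fun y hy => hMFCQ y (MapClusterPt.of_comp hκ1 hy)) ?_
  · have h1 := (hrun.multiplier (κ k)).1
    simp only [hP.gradE, hP.gradI] at h1
    rw [← sub_eq_zero.1 h1]
    exact hR _
  · have h1 := (hrun.multiplier (κ k)).lamI_mul_le hP (hrun.solution (κ k)).1 i
    rw [← hx] at h1
    have h2 : 0 ≤ s.θ (κ k) * max 0 (-P.cI i (s.x (κ k + 1))) :=
      mul_nonneg (hrun.theta_pos _).le (le_max_left _ _)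
    by_contra! h3
    have := mul_pos hi h3
    linarith
  · simp only [hlam]
    exact tendsto_atTop_add_const_right _ (-γ) (hθ.comp hκ1)

/-- The iterates are eventually feasible. -/
theorem IsSQPRun.eventually_feasible (hP : P.HasNormals aE aI) (hrun : IsSQPRun P η τ γ s)
    (hγ : 0 < γ) (hx : ∀ k, s.x (k + 1) = s.x k + s.d k) {Θ : ℝ} (hΘ : ∀ k, s.θ k ≤ Θ) :
    ∀ᶠ k in atTop, s.x k ∈ P.feasible := by
  have hlim := tendsto_atTop_ciSup hrun.theta_mono ⟨Θ, by rintro _ ⟨k, rfl⟩; exact hΘ k⟩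
  set θ' := ⨆ k, s.θ k
  have hle : ∀ k, s.θ k ≤ θ' := fun k => hrun.theta_mono.ge_of_tendsto hlim k
  -- For late m, the multiplier norms are at most θ_{m+1} - γ ≤ θ' - γ < θ_m; this strict gap is the
  -- purpose of γ.
  obtain ⟨N, hN⟩ := eventually_atTop.1
    (hlim.eventually (lt_mem_nhds (show θ' - γ < θ' by linarith)))
  refine eventually_atTop.2 ⟨N + 1, fun k hk => ?_⟩
  obtain ⟨m, rfl⟩ : ∃ m, k = m + 1 := ⟨k - 1, by omega⟩
  rw [hx]
  have h1 := hN m (by omega)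
  have h2 := hle (m + 1)
  rw [hrun.theta_succ] at h2
  have h3 := (le_max_right _ _).trans h2
  refine (hrun.multiplier m).add_mem_feasible hP (hrun.solution m).1 ?_ ?_
  · linarith [le_max_left ‖s.lamE m‖ ‖s.lamI m‖]
  · linarith [le_max_right ‖s.lamE m‖ ‖s.lamI m‖]

end Run

/-! ### Values and subgradients of the potential function. -/

section Potential

variable {X ιE ιI : Type*} [NormedAddCommGroup X] [InnerProductSpace ℝ X]
  {P : Problem X ιE ιI} {D : Set X} {σ l : ℝ}

theorem Problem.le_conjugate_convexPart {x : X} (hx : x ∈ D) (u : X) :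
    ((inner ℝ u x + P.f x - σ / 2 * ‖x‖ ^ 2 : ℝ) : EReal) ≤ conjugate (P.convexPart D σ) u := by
  refine le_trans (le_of_eq ?_)
    (le_iSup (fun x : X => ((inner ℝ u x : ℝ) : EReal) - P.convexPart D σ x) x)
  simp only [Problem.convexPart, if_pos hx]
  rw [← EReal.coe_sub]
  congr 1
  ring

/-- Equality in Fenchel-Young: `hu` says that `u` is a subgradient of the convex part at `x`. It is
used for u = σ x - g and for limits of such vectors. -/
theorem Problem.conjugate_convexPart_eq {x u : X} (hx : x ∈ D)
    (hu : ∀ y ∈ D, inner ℝ u y + P.f y - σ / 2 * ‖y‖ ^ 2 ≤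
      inner ℝ u x + P.f x - σ / 2 * ‖x‖ ^ 2) :
    conjugate (P.convexPart D σ) u =
      ((inner ℝ u x + P.f x - σ / 2 * ‖x‖ ^ 2 : ℝ) : EReal) := by
  refine le_antisymm (iSup_le fun y => ?_) (P.le_conjugate_convexPart hx u)
  by_cases hy : y ∈ D
  · simp only [Problem.convexPart, if_pos hy]
    rw [← EReal.coe_sub, EReal.coe_le_coe_iff]
    linarith [hu y hy]
  · simp only [Problem.convexPart, if_neg hy]
    simp

variable [CompleteSpace X] {aE : ιE → X} {aI : ιI → X}

/-- An affine function is its own linearization, so the indicator in the potential does not depend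
on `w` and is that of the feasible set. -/
theorem Problem.HasNormals.linE_eq (hP : P.HasNormals aE aI) (i : ιE) (x w : X) :
    P.linE i x w = P.cE i x := by
  rw [Problem.linE, hP.gradE, hP.affE i w x]

theorem Problem.HasNormals.linI_eq (hP : P.HasNormals aE aI) (i : ιI) (x w : X) :
    P.linI i x w = P.cI i x := by
  rw [Problem.linI, hP.gradI, hP.affI i w x]

theorem Problem.HasNormals.linIndicator_of_mem (hP : P.HasNormals aE aI) {x : X}
    (hx : x ∈ P.feasible) (w : X) : P.linIndicator x w = 0 := by
  exact if_pos ⟨fun i => (hP.linE_eq i x w).trans (hx.1 i),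
    fun i => (hx.2 i).trans_eq (hP.linI_eq i x w).symm⟩

theorem Problem.HasNormals.linIndicator_of_notMem (hP : P.HasNormals aE aI) {x : X}
    (hx : x ∉ P.feasible) (w : X) : P.linIndicator x w = ⊤ := by
  exact if_neg fun h => hx ⟨fun i => (hP.linE_eq i x w).symm.trans (h.1 i),
    fun i => (h.2 i).trans_eq (hP.linI_eq i x w)⟩

theorem Problem.HasNormals.potential_eq (hP : P.HasNormals aE aI)
    {z : PiLp 2 (fun _ : Fin 3 => X)} {x : X} (hx : x ∈ D) (hz : z 0 ∈ P.feasible)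
    (hu : ∀ y ∈ D, inner ℝ (z 1) y + P.f y - σ / 2 * ‖y‖ ^ 2 ≤
      inner ℝ (z 1) x + P.f x - σ / 2 * ‖x‖ ^ 2) :
    P.potential D σ l z = ((-inner ℝ (z 1) (z 0) + (inner ℝ (z 1) x + P.f x - σ / 2 * ‖x‖ ^ 2) +
      (σ / 2 * ‖z 0‖ ^ 2 + l / 2 * ‖z 0 - z 2‖ ^ 2) : ℝ) : EReal) := by
  rw [Problem.potential, P.conjugate_convexPart_eq hx hu, hP.linIndicator_of_mem hz, add_zero,
    ← EReal.coe_add, ← EReal.coe_add]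

/-- Fenchel-Young with `x` fixed while `z` varies. On points with feasible `z 0` this is a smooth
minorant of the potential, exact where `z 1` is a subgradient at `x`; the regular subgradient is
read off from it. -/
theorem Problem.HasNormals.le_potential (hP : P.HasNormals aE aI)
    {z : PiLp 2 (fun _ : Fin 3 => X)} {x : X} (hx : x ∈ D) (hz : z 0 ∈ P.feasible) :
    ((-inner ℝ (z 1) (z 0) + (inner ℝ (z 1) x + P.f x - σ / 2 * ‖x‖ ^ 2) +
      (σ / 2 * ‖z 0‖ ^ 2 + l / 2 * ‖z 0 - z 2‖ ^ 2) : ℝ) : EReal) ≤ P.potential D σ l z := by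
  rw [Problem.potential, hP.linIndicator_of_mem hz, add_zero, EReal.coe_add, EReal.coe_add]
  gcongr
  exact P.le_conjugate_convexPart hx _

theorem Problem.HasNormals.potential_eq_top (hP : P.HasNormals aE aI)
    {z : PiLp 2 (fun _ : Fin 3 => X)} {x : X} (hx : x ∈ D) (hz : z 0 ∉ P.feasible) :
    P.potential D σ l z = ⊤ := by
  rw [Problem.potential, hP.linIndicator_of_notMem hz]
  refine EReal.add_top_of_ne_bot ?_
  have h := P.le_conjugate_convexPart (σ := σ) hx (z 1)
  rw [← bot_lt_iff_ne_bot]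
  refine lt_of_lt_of_le ?_ (add_le_add (add_le_add le_rfl h) le_rfl)
  rw [← EReal.coe_add, ← EReal.coe_add]
  exact EReal.bot_lt_coe _

/-- A regular subgradient of the potential function at a point `(x⁺, u, w)` such that `u` is a
subgradient at `x` of the convex part, built from a normal vector `ν` of the feasible set at
`x⁺`. -/
theorem Problem.HasNormals.mem_regularSubdiff_potential (hP : P.HasNormals aE aI)
    (hσ : 0 ≤ σ) (hl : 0 ≤ l)
    {z : PiLp 2 (fun _ : Fin 3 => X)} {x ν : X} (hx : x ∈ D) (hz : z 0 ∈ P.feasible)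
    (hu : ∀ y ∈ D, inner ℝ (z 1) y + P.f y - σ / 2 * ‖y‖ ^ 2 ≤
      inner ℝ (z 1) x + P.f x - σ / 2 * ‖x‖ ^ 2)
    (hν : ∀ y ∈ P.feasible, inner ℝ ν (y - z 0) ≤ 0) :
    WithLp.toLp 2 ![-z 1 + σ • z 0 + l • (z 0 - z 2) + ν, x - z 0, -(l • (z 0 - z 2))] ∈
      regularSubdiff (P.potential D σ l) z := by
  have hz' := hP.potential_eq (l := l) hx hz hu
  refine ⟨by rw [hz']; exact EReal.coe_ne_top _, by rw [hz']; exact EReal.coe_ne_bot _, ?_⟩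
  intro ε hε
  -- The only nonconvex term is the bilinear one. Its remainder is at most ‖z' - z‖², hence at most
  -- ε‖z' - z‖ on the ball of radius ε.
  filter_upwards [Metric.closedBall_mem_nhds z hε] with z' hzz
  by_cases hf : z' 0 ∈ P.feasible
  · refine le_trans ?_ (hP.le_potential (l := l) hx hf)
    rw [hz', ← EReal.coe_add, EReal.coe_le_coe_iff, PiLp.inner_apply, Fin.sum_univ_three]
    simp only [Matrix.cons_val_zero, Matrix.cons_val_one, Matrix.cons_val, PiLp.sub_apply]
    have hn : ‖z' - z‖ ≤ ε := by rwa [Metric.mem_closedBall, dist_eq_norm] at hzz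
    have hb1 : ‖z' 1 - z 1‖ ≤ ‖z' - z‖ := PiLp.norm_apply_le (z' - z) 1
    have hb0 : ‖z' 0 - z 0‖ ≤ ‖z' - z‖ := PiLp.norm_apply_le (z' - z) 0
    have h1 : inner ℝ (z' 1 - z 1) (z' 0 - z 0) ≤ ε * ‖z' - z‖ :=
      (real_inner_le_norm _ _).trans
        (mul_le_mul (hb1.trans hn) hb0 (norm_nonneg _) hε.le)
    have h2 := hν _ hf
    generalize ‖z' - z‖ = N at h1 ⊢
    obtain ⟨a, ha⟩ : ∃ a, z' 0 = z 0 + a := ⟨z' 0 - z 0, by abel⟩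
    obtain ⟨β, hβ⟩ : ∃ β, z' 1 = z 1 + β := ⟨z' 1 - z 1, by abel⟩
    obtain ⟨e, he⟩ : ∃ e, z' 2 = z 2 + e := ⟨z' 2 - z 2, by abel⟩
    rw [ha, hβ, add_sub_cancel_left, add_sub_cancel_left] at h1
    rw [ha, add_sub_cancel_left] at h2
    rw [ha, hβ, he, add_sub_cancel_left, add_sub_cancel_left, add_sub_cancel_left,
      show z 0 + a - (z 2 + e) = (z 0 - z 2) + (a - e) by abel]
    generalize z 0 - z 2 = p
    rw [norm_add_sq_real (z 0) a, norm_add_sq_real p (a - e)]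
    simp only [inner_add_left, inner_add_right, inner_sub_left, inner_sub_right, inner_neg_left,
      real_inner_smul_left] at h1 ⊢
    have h3 : 0 ≤ σ / 2 * ‖a‖ ^ 2 := by positivity
    have h4 : 0 ≤ l / 2 * ‖a - e‖ ^ 2 := by positivity
    rw [real_inner_comm β x, real_inner_comm β (z 0)]
    linarith
  · rw [hP.potential_eq_top hx hf]
    exact le_top

end Potential

/-! ### From the KL inequality to linear rates. -/

/-- The Kurdyka-Łojasiewicz property with exponent at most `1/2` bounds the function gap along a
sequence by the square of the subgradient error. -/
theorem IsKLFunctionWithExponent.eventually_sub_le {Z : Type*} [NormedAddCommGroup Z]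
    [InnerProductSpace ℝ Z] {h : Z → EReal} {α : ℝ} (hKL : IsKLFunctionWithExponent h α)
    (hα : α ∈ Ioc (0 : ℝ) (1 / 2)) {S : Set Z} (hS : IsCompact S) {z ξ : ℕ → Z} {ℓ e : ℕ → ℝ}
    {ℓ' C : ℝ} (hzS : ∀ k, z k ∈ S) (hhz : ∀ k, h (z k) = ℓ k) (hℓ : Tendsto ℓ atTop (𝓝 ℓ'))
    (hclosed : ∀ φ : ℕ → ℕ, StrictMono φ → ∀ z', Tendsto (z ∘ φ) atTop (𝓝 z') → h z' = ℓ')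
    (hξ : ∀ k, ξ k ∈ regularSubdiff h (z k)) (hξe : ∀ k, ‖ξ k‖ ≤ C * e k)
    (he0 : Tendsto e atTop (𝓝 0)) :
    ∃ M > 0, ∀ᶠ k in atTop, ℓ k - ℓ' ≤ M * e k ^ 2 := by
  by_contra! hcon
  obtain ⟨φ, hφ, hφ'⟩ := extraction_forall_of_frequently
    (P := fun (n : ℕ) k => ((n : ℝ) + 1) * e k ^ 2 < ℓ k - ℓ')
    (fun n => by simpa only [not_eventually, not_le] using hcon (n + 1) (by positivity))
  obtain ⟨z', -, ψ, hψ, hz'⟩ := hS.tendsto_subseq (x := z ∘ φ) (fun k => hzS _)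
  have hφψ : StrictMono (φ ∘ ψ) := hφ.comp hψ
  have hh' : h z' = ℓ' := hclosed _ hφψ _ hz'
  have hℓ2 : Tendsto (fun k => ℓ (φ (ψ k))) atTop (𝓝 ℓ') := hℓ.comp hφψ.tendsto_atTop
  have hξ0 : Tendsto (fun k => ξ (φ (ψ k))) atTop (𝓝 0) := by
    refine squeeze_zero_norm (fun k => hξe _) ?_
    simpa using (he0.comp hφψ.tendsto_atTop).const_mul C
  -- Since ξ → 0 with convergence of the function values, 0 is a limiting subgradient at the cluster
  -- point, which therefore lies in the domain where the KL property is assumed.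
  obtain ⟨r, U, a₀, hU, hdes, hineq⟩ := hKL z' ⟨0, by rw [hh']; exact EReal.coe_ne_top _,
    by rw [hh']; exact EReal.coe_ne_bot _, fun k => z (φ (ψ k)), fun k => ξ (φ (ψ k)), hz',
    by simp only [hhz, hh']; exact (continuous_coe_real_ereal.tendsto ℓ').comp hℓ2,
    fun k => hξ _, hξ0⟩
  have hlt : (ℓ' : EReal) < ℓ' + r := by
    have := hdes.eta_pos
    induction r with
    | bot => simp at this
    | top => simp
    | coe r =>
      rw [← EReal.coe_add, EReal.coe_lt_coe_iff]
      have : 0 < r := by exact_mod_cast this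
      linarith
  set A : ℝ := a₀ * (1 - α) * C with hA
  have e1 : ∀ᶠ k in atTop, z (φ (ψ k)) ∈ U := hz'.eventually hU
  have e2 : ∀ᶠ k in atTop, (ℓ (φ (ψ k)) : EReal) < ℓ' + r :=
    ((continuous_coe_real_ereal.tendsto ℓ').comp hℓ2).eventually (gt_mem_nhds hlt)
  -- A gap below 1 is what allows √s ≤ s^α for α ≤ 1/2.
  have e3 : ∀ᶠ k in atTop, ℓ (φ (ψ k)) < ℓ' + 1 := hℓ2.eventually (gt_mem_nhds (by linarith))
  have e4 : ∀ᶠ k in atTop, A ^ 2 < (ψ k : ℝ) + 1 :=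
    (tendsto_atTop_add_const_right _ (1 : ℝ)
      (tendsto_natCast_atTop_atTop.comp hψ.tendsto_atTop)).eventually_gt_atTop _
  obtain ⟨k, h1, h2, h3, h4⟩ := (e1.and (e2.and (e3.and e4))).exists
  have hlarge := hφ' (ψ k)
  set m := φ (ψ k)
  have hs : 0 < ℓ m - ℓ' :=
    lt_of_le_of_lt (mul_nonneg (by positivity) (sq_nonneg _)) hlarge
  have hkl := hineq (z m) h1
    (by rw [hh', hhz, EReal.coe_lt_coe_iff]; linarith) (by rw [hh', hhz]; exact h2)
  have hder : deriv (fun s : ℝ => a₀ * s ^ (1 - α)) (ℓ m - ℓ') =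
      a₀ * (1 - α) * (ℓ m - ℓ') ^ (-α) := by
    rw [((Real.hasDerivAt_rpow_const (p := 1 - α) (Or.inl hs.ne')).const_mul a₀).deriv]
    rw [show 1 - α - 1 = -α by ring]; ring
  rw [hhz, hh', ← EReal.coe_sub, EReal.toReal_coe, hder] at hkl
  have hdist : Metric.infEDist (0 : Z) (limitingSubdiff h (z m)) ≤ ENNReal.ofReal ‖ξ m‖ := by
    have hmem : ξ m ∈ limitingSubdiff h (z m) :=
      ⟨(hξ m).1, (hξ m).2.1, fun _ => z m, fun _ => ξ m, tendsto_const_nhds, tendsto_const_nhds,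
        fun _ => hξ m, tendsto_const_nhds⟩
    refine (Metric.infEDist_le_edist_of_mem hmem).trans_eq ?_
    rw [edist_dist, dist_zero_left]
  have h5 := hkl.trans (mul_le_mul_right hdist _)
  rw [← ENNReal.ofReal_mul' (norm_nonneg _), ENNReal.one_le_ofReal] at h5
  -- The sign is forced by the KL inequality itself, since the product with ‖ξ‖ is at least 1.
  have hpos : 0 < a₀ * (1 - α) * (ℓ m - ℓ') ^ (-α) := by
    by_contra! hle
    linarith [mul_nonpos_of_nonpos_of_nonneg hle (norm_nonneg (ξ m))]
  have h6 := h5.trans (mul_le_mul_of_nonneg_left (hξe m) hpos.le)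
  have hsα : 0 < (ℓ m - ℓ') ^ α := Real.rpow_pos_of_pos hs α
  have h7 : (ℓ m - ℓ') ^ α ≤ A * e m := by
    have h8 := mul_le_mul_of_nonneg_left h6 hsα.le
    have h9 : (ℓ m - ℓ') ^ α * (ℓ m - ℓ') ^ (-α) = 1 := by
      rw [← Real.rpow_add hs]; simp
    calc (ℓ m - ℓ') ^ α = (ℓ m - ℓ') ^ α * 1 := (mul_one _).symm
      _ ≤ _ := h8
      _ = ((ℓ m - ℓ') ^ α * (ℓ m - ℓ') ^ (-α)) * (A * e m) := by rw [hA]; ring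
      _ = A * e m := by rw [h9, one_mul]
  have h10 : Real.sqrt (ℓ m - ℓ') ≤ A * e m := by
    rw [Real.sqrt_eq_rpow]
    exact (Real.rpow_le_rpow_of_exponent_ge hs (by linarith) hα.2).trans h7
  have h11 : ℓ m - ℓ' ≤ A ^ 2 * e m ^ 2 := by
    rw [← mul_pow]
    exact (Real.sqrt_le_left ((Real.sqrt_nonneg _).trans h10)).1 h10
  have h12 := mul_le_mul_of_nonneg_right h4.le (sq_nonneg (e m))
  linarith

/-- Sufficient decrease and a quadratic bound of the function gap yield R-linear convergence. -/
theorem exists_tendsto_linear_rate {E : Type*} [NormedAddCommGroup E] [CompleteSpace E]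
    {x : ℕ → E} {ℓ e : ℕ → ℝ} {ℓ' c M : ℝ} (hc : 0 < c) (hM : 0 < M) (N : ℕ)
    (hlow : ∀ k ≥ N, ℓ' ≤ ℓ k) (hdec : ∀ k ≥ N, ℓ (k + 1) ≤ ℓ k - c * e k ^ 2)
    (hgap : ∀ k ≥ N, ℓ k - ℓ' ≤ M * e k ^ 2) (hx : ∀ k ≥ N, dist (x k) (x (k + 1)) ≤ e k) :
    ∃ x' : E, Tendsto x atTop (𝓝 x') ∧ ∃ q₀ ∈ Ioo (0 : ℝ) 1, ∃ q₁ > (0 : ℝ),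
      ∀ᶠ k in atTop, ‖x k - x'‖ ≤ q₁ * q₀ ^ k := by
  -- The factor 1 - c/M would be sharper but may fail to be positive; M/(M + c) always lies in (0,
  -- 1).
  set q : ℝ := M / (M + c) with hq
  have hq0 : 0 < q := by positivity
  have hq1 : q < 1 := by rw [hq, div_lt_one (by positivity)]; linarith
  set r : ℝ := Real.sqrt q with hr
  have hr0 : 0 < r := Real.sqrt_pos.2 hq0
  have hr1 : r < 1 := by rw [hr, Real.sqrt_lt' one_pos]; simpa using hq1
  have hstep : ∀ k ≥ N, ℓ (k + 1) - ℓ' ≤ q * (ℓ k - ℓ') := by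
    intro k hk
    have h1 := hdec k hk
    have h2 := hgap k hk
    rw [hq, div_mul_eq_mul_div, le_div_iff₀ (by positivity)]
    nlinarith [sq_nonneg (e k), mul_le_mul_of_nonneg_left h2 hc.le, mul_nonneg hc.le (sq_nonneg (e k)),
      mul_nonneg hc.le (mul_nonneg hc.le (sq_nonneg (e k)))]
  have hgeo : ∀ k, ℓ (N + k) - ℓ' ≤ q ^ k * (ℓ N - ℓ') := by
    intro k
    induction k with
    | zero => simp
    | succ k ih =>
      refine (hstep (N + k) (by omega)).trans ?_
      rw [pow_succ']
      nlinarith [mul_le_mul_of_nonneg_left ih hq0.le]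
  set C : ℝ := Real.sqrt ((ℓ N - ℓ') / c) with hC
  have he : ∀ k, e (N + k) ≤ C * r ^ k := by
    intro k
    -- One step's decrease cannot exceed the remaining gap, so c e² ≤ q^k(ℓ_N - ℓ'). The square root
    -- gives the rate r = √q.
    have h1 : e (N + k) ^ 2 ≤ (ℓ N - ℓ') / c * q ^ k := by
      rw [div_mul_eq_mul_div, le_div_iff₀ hc]
      have h2 := hdec (N + k) (by omega)
      have h3 := hlow (N + k + 1) (by omega)
      have h4 := hgeo k
      linarith
    refine (Real.le_sqrt_of_sq_le h1).trans_eq ?_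
    rw [Real.sqrt_mul' _ (by positivity), hC, hr]
    congr 1
    rw [Real.sqrt_eq_iff_mul_self_eq (by positivity) (by positivity), ← mul_pow,
      Real.mul_self_sqrt hq0.le]
  have hd : ∀ k, dist (x (N + k)) (x (N + (k + 1))) ≤ C * r ^ k := fun k =>
    (hx (N + k) (by omega)).trans (he k)
  obtain ⟨x', hx'⟩ := cauchySeq_tendsto_of_complete
    (cauchySeq_of_le_geometric (f := fun k => x (N + k)) r C hr1 hd)
  -- C/(1 - r) bounds the geometric tail, r^N undoes the index shift, and the added 1 keeps the
  -- constant positive when C = 0.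
  refine ⟨x', ?_, r, ⟨hr0, hr1⟩, C / (1 - r) / r ^ N + 1, ?_, ?_⟩
  · rw [← tendsto_add_atTop_iff_nat N]
    simpa only [add_comm] using hx'
  · have : 0 ≤ C := Real.sqrt_nonneg _
    have : 0 < 1 - r := by linarith
    positivity
  · refine eventually_atTop.2 ⟨N, fun k hk => ?_⟩
    obtain ⟨m, rfl⟩ := Nat.exists_eq_add_of_le hk
    have h1 := dist_le_of_le_geometric_of_tendsto r C hr1 hd hx' m
    rw [dist_eq_norm] at h1
    refine h1.trans ?_
    have h2 : C / (1 - r) / r ^ N * r ^ (N + m) = C * r ^ m / (1 - r) := by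
      rw [pow_add]; field_simp
    have h3 : 0 < r ^ (N + m) := by positivity
    linarith

/-! ### Convergence of the feasible tail. -/

section Convergence

variable {X ιE ιI : Type*} [NormedAddCommGroup X] [InnerProductSpace ℝ X] [FiniteDimensional ℝ X]
  [CompleteSpace X] [Fintype ιE] [Fintype ιI] {P : Problem X ιE ιI} {aE : ιE → X} {aI : ιI → X}
  {D : Set X} {σ l b α : ℝ}

/-- Linear convergence of sequences of feasible points generated by unit steps which satisfy the
variational inequality of the quadratic subproblem, if the potential function is a KL function
with exponent at most `1/2`. -/
theorem Problem.HasNormals.exists_tendsto_linear_rate (hP : P.HasNormals aE aI)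
    (hD : IsCompact D) (hfD : ContinuousOn P.f D) {x g d : ℕ → X} {B : ℕ → X →L[ℝ] X}
    (hxD : ∀ k, x k ∈ D) (hx : ∀ k, x (k + 1) = x k + d k) (hfeas : ∀ k, x k ∈ P.feasible)
    {K M : ℝ} (hg : ∀ k, ‖g k‖ ≤ K) (hBM : ∀ k, ‖B k‖ ≤ M)
    (hB_pos : ∀ k d, b * ‖d‖ ^ 2 ≤ inner ℝ d (B k d))
    (hquad : ∀ k, ∀ y ∈ D, P.f y ≤ P.f (x k) + inner ℝ (g k) (y - x k) + σ / 2 * ‖y - x k‖ ^ 2)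
    (hvar : ∀ k, ∀ y ∈ P.feasible, 0 ≤ inner ℝ (g k + B k (d k)) (y - x (k + 1)))
    (hσ : 0 < σ) (hl : 0 < l) (hbl : σ + l ≤ 2 * b) (hα : α ∈ Ioc (0 : ℝ) (1 / 2))
    (hKL : IsKLFunctionWithExponent (P.potential D σ l) α) :
    ∃ x' : X, Tendsto x atTop (𝓝 x') ∧ ∃ q₀ ∈ Ioo (0 : ℝ) 1, ∃ q₁ > (0 : ℝ),
      ∀ᶠ k in atTop, ‖x k - x'‖ ≤ q₁ * q₀ ^ k := by
  have hd : ∀ k, d k = x (k + 1) - x k := fun k => by rw [hx, add_sub_cancel_left]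
  set u : ℕ → X := fun k => σ • x k - g k with hu_def
  let Φ : X × X × X → PiLp 2 (fun _ : Fin 3 => X) := fun q => WithLp.toLp 2 ![q.1, q.2.1, q.2.2]
  have hΦ : Continuous Φ := by
    refine (PiLp.continuous_toLp 2 _).comp (continuous_pi fun i => ?_)
    fin_cases i
    · exact continuous_fst
    · exact continuous_fst.comp continuous_snd
    · exact continuous_snd.comp continuous_snd
  set z : ℕ → PiLp 2 (fun _ : Fin 3 => X) := fun k => Φ (x (k + 1), u k, x k) with hz_def
  set ℓ : ℕ → ℝ := fun k => P.f (x k) + inner ℝ (g k) (d k) + (σ + l) / 2 * ‖d k‖ ^ 2 with hℓ_def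
  obtain ⟨C, hC⟩ := hD.isBounded.exists_norm_le
  have hu : ∀ k, ∀ y ∈ D, inner ℝ (u k) y + P.f y - σ / 2 * ‖y‖ ^ 2 ≤
      inner ℝ (u k) (x k) + P.f (x k) - σ / 2 * ‖x k‖ ^ 2 := by
    intro k y hy
    have h1 := hquad k y hy
    rw [norm_sub_sq_real] at h1
    simp only [hu_def, inner_sub_left, inner_sub_right, real_inner_smul_left] at h1 ⊢
    rw [real_inner_self_eq_norm_sq, real_inner_comm y (x k)]
    linarith
  have hub : ∀ k, u k ∈ Metric.closedBall (0 : X) (σ * C + K) := by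
    intro k
    rw [mem_closedBall_zero_iff]
    refine (norm_sub_le _ _).trans (add_le_add ?_ (hg k))
    rw [norm_smul, Real.norm_eq_abs, abs_of_pos hσ]
    exact mul_le_mul_of_nonneg_left (hC _ (hxD k)) hσ.le
  have hS : IsCompact (Φ '' (D ×ˢ Metric.closedBall (0 : X) (σ * C + K) ×ˢ D)) :=
    (hD.prod ((isCompact_closedBall _ _).prod hD)).image hΦ
  have hzS : ∀ k, z k ∈ Φ '' (D ×ˢ Metric.closedBall (0 : X) (σ * C + K) ×ˢ D) := fun k =>
    ⟨_, ⟨hxD _, hub k, hxD k⟩, rfl⟩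
  have hz0 : ∀ k, z k 0 = x (k + 1) := fun k => rfl
  have hz1 : ∀ k, z k 1 = u k := fun k => rfl
  have hz2 : ∀ k, z k 2 = x k := fun k => rfl
  have hLz : ∀ k, P.potential D σ l (z k) = ℓ k := by
    intro k
    rw [hP.potential_eq (hxD k) (by rw [hz0]; exact hfeas _) (by rw [hz1]; exact hu k), hz0, hz1,
      hz2, hx, add_sub_cancel_left, norm_add_sq_real]
    congr 1
    simp only [hu_def, hℓ_def, inner_add_right, inner_sub_left, real_inner_smul_left]
    ring
  -- The variational inequality at y = x_k gives ⟨g_k, d_k⟩ ≤ -b‖d_k‖², which absorbs ((σ +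
  -- l)/2)‖d_k‖².
  have hup : ∀ k, ℓ k ≤ P.f (x k) := by
    intro k
    have h1 := hvar k (x k) (hfeas k)
    rw [hx, sub_add_cancel_left, inner_neg_right, inner_add_left,
      real_inner_comm (d k) (B k (d k))] at h1
    have h2 := hB_pos k (d k)
    have h3 := mul_le_mul_of_nonneg_right hbl (sq_nonneg ‖d k‖)
    simp only [hℓ_def]
    linarith
  have hlo : ∀ k, P.f (x (k + 1)) ≤ ℓ k - l / 2 * ‖d k‖ ^ 2 := by
    intro k
    have h1 := hquad k _ (hxD (k + 1))
    rw [← hd] at h1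
    simp only [hℓ_def]
    linarith
  have hdec : ∀ k, ℓ (k + 1) ≤ ℓ k - l / 2 * ‖d k‖ ^ 2 := fun k => (hup _).trans (hlo k)
  have hnn : ∀ k, 0 ≤ l / 2 * ‖d k‖ ^ 2 := fun k => by positivity
  have hanti : Antitone ℓ := antitone_nat_of_succ_le fun k => by linarith [hdec k, hnn k]
  obtain ⟨m, hm⟩ := (hD.image_of_continuousOn hfD).bddBelow
  have hℓ_bdd : BddBelow (range ℓ) := ⟨m, by
    rintro _ ⟨k, rfl⟩
    have := hm (mem_image_of_mem _ (hxD (k + 1)))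
    linarith [hlo k, hnn k]⟩
  have hlim := tendsto_atTop_ciInf hanti hℓ_bdd
  set ℓ' := ⨅ k, ℓ k
  have hge : ∀ k, ℓ' ≤ ℓ k := fun k => hanti.le_of_tendsto hlim k
  have hlim1 : Tendsto (fun k => ℓ (k + 1)) atTop (𝓝 ℓ') := (tendsto_add_atTop_iff_nat 1).2 hlim
  have hd0 : Tendsto (fun k => ‖d k‖) atTop (𝓝 0) := by
    have h1 : Tendsto (fun k => Real.sqrt (2 / l * (ℓ k - ℓ (k + 1)))) atTop (𝓝 0) := by
      have := ((hlim.sub hlim1).const_mul (2 / l)).sqrt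
      simpa using this
    refine squeeze_zero (fun k => norm_nonneg _) (fun k => Real.le_sqrt_of_sq_le ?_) h1
    rw [div_mul_eq_mul_div, le_div_iff₀ hl]
    linarith [hdec k]
  have hf1 : Tendsto (fun k => P.f (x (k + 1))) atTop (𝓝 ℓ') :=
    tendsto_of_tendsto_of_tendsto_of_le_of_le hlim1 hlim (fun k => hup (k + 1))
      fun k => by linarith [hlo k, hnn k]
  have hf0 : Tendsto (fun k => P.f (x k)) atTop (𝓝 ℓ') := (tendsto_add_atTop_iff_nat 1).1 hf1
  -- The conjugate is not known to be continuous along the sequence. Instead the subgradient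
  -- inequality `hu` passes to the limit, Fenchel equality holds there, and as d → 0 the value
  -- collapses to f at the limit point.
  have hclosed : ∀ φ : ℕ → ℕ, StrictMono φ → ∀ z', Tendsto (z ∘ φ) atTop (𝓝 z') →
      P.potential D σ l z' = ℓ' := by
    intro φ hφ z' hz'
    have c : ∀ i, Tendsto (fun k => z (φ k) i) atTop (𝓝 (z' i)) := fun i =>
      (Continuous.tendsto (by fun_prop :
        Continuous fun y : PiLp 2 (fun _ : Fin 3 => X) => y i) z').comp hz'
    have c0 : Tendsto (fun k => x (φ k + 1)) atTop (𝓝 (z' 0)) := c 0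
    have c1 : Tendsto (fun k => u (φ k)) atTop (𝓝 (z' 1)) := c 1
    have c2 : Tendsto (fun k => x (φ k)) atTop (𝓝 (z' 2)) := c 2
    have h02 : z' 0 = z' 2 := by
      have h1 : Tendsto (fun k => d (φ k)) atTop (𝓝 (z' 0 - z' 2)) :=
        (c0.sub c2).congr fun k => (hd _).symm
      have h2 : Tendsto (fun k => d (φ k)) atTop (𝓝 0) :=
        (tendsto_zero_iff_norm_tendsto_zero.2 hd0).comp hφ.tendsto_atTop
      exact sub_eq_zero.1 (tendsto_nhds_unique h1 h2)
    have hD2 : z' 2 ∈ D := hD.isClosed.mem_of_tendsto c2 (Eventually.of_forall fun k => hxD _)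
    have hF2 : z' 2 ∈ P.feasible := by
      rw [← P.violation_eq_zero_iff]
      refine tendsto_nhds_unique ((hP.continuous_violation.tendsto _).comp c2)
        (tendsto_const_nhds.congr fun k => ?_)
      exact (P.violation_eq_zero_iff.2 (hfeas (φ k))).symm
    have hfc : Tendsto (fun k => P.f (x (φ k))) atTop (𝓝 (P.f (z' 2))) :=
      (hfD _ hD2).tendsto.comp (tendsto_nhdsWithin_iff.2 ⟨c2, Eventually.of_forall fun k => hxD _⟩)
    have hf' : P.f (z' 2) = ℓ' := tendsto_nhds_unique hfc (hf0.comp hφ.tendsto_atTop)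
    have hu' : ∀ y ∈ D, inner ℝ (z' 1) y + P.f y - σ / 2 * ‖y‖ ^ 2 ≤
        inner ℝ (z' 1) (z' 2) + P.f (z' 2) - σ / 2 * ‖z' 2‖ ^ 2 := by
      intro y hy
      refine le_of_tendsto_of_tendsto' (((c1.inner tendsto_const_nhds).add_const _).sub_const _)
        (((c1.inner c2).add hfc).sub ((c2.norm.pow 2).const_mul _)) fun k => hu (φ k) y hy
    rw [hP.potential_eq hD2 (by rw [h02]; exact hF2) hu', h02, ← hf', sub_self]
    congr 1
    rw [norm_zero]
    ring
  -- The general subgradient with normal vector -(g + B d): the terms in g and x_k cancel, so every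
  -- component is linear in d.
  let ξ : ℕ → PiLp 2 (fun _ : Fin 3 => X) := fun k =>
    Φ ((σ + l) • d k - B k (d k), -d k, -(l • d k))
  have hξ : ∀ k, ξ k ∈ regularSubdiff (P.potential D σ l) (z k) := by
    intro k
    have h := hP.mem_regularSubdiff_potential (l := l) hσ.le hl.le (z := z k)
      (ν := -(g k + B k (d k))) (hxD k)
      (by rw [hz0]; exact hfeas _) (by rw [hz1]; exact hu k)
      (fun y hy => by rw [hz0, inner_neg_left]; linarith [hvar k y hy])
    have e : ξ k = WithLp.toLp 2 ![-z k 1 + σ • z k 0 + l • (z k 0 - z k 2) + -(g k + B k (d k)),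
        x k - z k 0, -(l • (z k 0 - z k 2))] := by
      rw [hz0, hz1, hz2, ← hd, ← neg_sub (x (k + 1)), ← hd]
      have : -u k + σ • x (k + 1) + l • d k + -(g k + B k (d k)) =
          (σ + l) • d k - B k (d k) := by
        rw [hx]; simp only [hu_def]; module
      rw [this]
    rw [e]; exact h
  have hM0 : 0 ≤ M := (norm_nonneg _).trans (hBM 0)
  have hξb : ∀ k, ‖ξ k‖ ≤ ((σ + l + M) + 1 + l) * ‖d k‖ := by
    intro k
    have e : ξ k = PiLp.single 2 0 ((σ + l) • d k - B k (d k)) + PiLp.single 2 1 (-d k) +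
        PiLp.single 2 2 (-(l • d k)) := by
      ext i : 1
      fin_cases i <;> simp [ξ, Φ]
    have n0 : ‖(σ + l) • d k - B k (d k)‖ ≤ (σ + l + M) * ‖d k‖ := by
      refine (norm_sub_le _ _).trans ?_
      rw [norm_smul, Real.norm_eq_abs, abs_of_pos (by positivity)]
      have := ((B k).le_opNorm (d k)).trans (mul_le_mul_of_nonneg_right (hBM k) (norm_nonneg _))
      linarith
    rw [e]
    refine (norm_add₃_le).trans ?_
    rw [PiLp.norm_single, PiLp.norm_single, PiLp.norm_single, norm_neg, norm_neg, norm_smul,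
      Real.norm_eq_abs, abs_of_pos hl]
    linarith
  obtain ⟨M', hM', hgap⟩ := hKL.eventually_sub_le hα hS hzS hLz hlim hclosed hξ
    hξb hd0
  obtain ⟨N, hN⟩ := eventually_atTop.1 hgap
  exact NonsmoothSQP.exists_tendsto_linear_rate (half_pos hl) hM' N (fun k _ => hge k)
    (fun k _ => hdec k) hN fun k _ => by rw [dist_comm, dist_eq_norm, ← hd]

end Convergence

end NonsmoothSQP

/-! ### Application to the algorithm. -/

theorem mainTheorem4 {n : ℕ} {ιE ιI : Type*} [Fintype ιE] [Fintype ιI]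
    (P : NonsmoothSQP.Problem (EuclideanSpace ℝ (Fin n)) ιE ιI)
    (O D : Set (EuclideanSpace ℝ (Fin n)))
    (s : NonsmoothSQP.SQPSequences (EuclideanSpace ℝ (Fin n)) ιE ιI)
    (η τ γ b ρ σ l α : ℝ)
    -- the objective
    (hO : IsOpen O) (hf_lip : ∃ K, LipschitzOnWith K P.f O)
    (hf_upper : NonsmoothSQP.UpperC2On P.f O)
    -- the constraints
    (haff : P.AffineConstraints) (hne : P.feasible.Nonempty)
    -- the compact convex set on which the method works
    (hD_compact : IsCompact D) (hD_convex : Convex ℝ D) (hDO : D ⊆ O)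
    (hfeasD : P.feasible ⊆ D)
    -- the constant of upper-C² smoothness on it
    (hρ : 0 < ρ) (hρ_convex : ConvexOn ℝ D (fun x => -P.f x + ρ / 2 * ‖x‖ ^ 2))
    -- the run of the algorithm
    (hη : η ∈ Set.Ioo (0 : ℝ) 1) (hτ : τ ∈ Set.Ioo (0 : ℝ) 1) (hγ : 0 < γ)
    (hrun : NonsmoothSQP.IsSQPRun P η τ γ s)
    (hxD : ∀ k, s.x k ∈ D) (hxdD : ∀ k, s.x k + s.d k ∈ D)
    (hB_symm : ∀ k, ((s.B k : EuclideanSpace ℝ (Fin n) →L[ℝ] EuclideanSpace ℝ (Fin n)) :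
      EuclideanSpace ℝ (Fin n) →ₗ[ℝ] EuclideanSpace ℝ (Fin n)).IsSymmetric)
    (hB_bdd : ∃ M : ℝ, ∀ k, ‖s.B k‖ ≤ M)
    (hb : 0 < b) (hB_pos : ∀ k d, b * ‖d‖ ^ 2 ≤ inner ℝ d (s.B k d))
    (hMFCQ : ∀ y, MapClusterPt y Filter.atTop s.x → P.MFCQ y)
    -- the potential function
    (hσ : 0 < σ) (hl : 0 < l)
    (hα : α ∈ Set.Ioc (0 : ℝ) (1 / 2))
    (hKL : NonsmoothSQP.IsKLFunctionWithExponent (P.potential D σ l) α)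
    -- the relations between the constants
    (hbσ : σ ≤ b) (hσρ : ρ ≤ σ) (hbl : σ + l ≤ 2 * b) :
    ∃ xbar : EuclideanSpace ℝ (Fin n), Filter.Tendsto s.x Filter.atTop (nhds xbar) ∧
      ∃ q₀ ∈ Set.Ioo (0 : ℝ) 1, ∃ q₁ > (0 : ℝ),
        ∀ᶠ k in Filter.atTop, ‖s.x k - xbar‖ ≤ q₁ * q₀ ^ k := by
  obtain ⟨K, hK⟩ := hf_lip
  obtain ⟨M, hM⟩ := hB_bdd
  obtain ⟨aE, aI, hP⟩ := haff.exists_hasNormals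
  obtain ⟨C, hC⟩ := hD_compact.isBounded.exists_norm_le
  have hOx : ∀ k, O ∈ 𝓝 (s.x k) := fun k => hO.mem_nhds (hDO (hxD k))
  have hg : ∀ k, ‖s.g k‖ ≤ K := fun k =>
    NonsmoothSQP.norm_le_of_mem_clarkeSubdiff (hOx k) hK (hrun.subgradient k)
  have hquad : ∀ k, ∀ y ∈ D, P.f y ≤
      P.f (s.x k) + inner ℝ (s.g k) (y - s.x k) + ρ / 2 * ‖y - s.x k‖ ^ 2 := fun k y hy =>
    hf_upper.le_quadratic (hDO (hxD k)) (hK.continuousOn.continuousAt (hOx k))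
      (hrun.subgradient k) hρ_convex (hxD k) hy
  have hx : ∀ k, s.x (k + 1) = s.x k + s.d k :=
    hrun.x_succ hP hη.2.le hb (hσρ.trans hbσ) hB_pos fun k => by
      simpa only [add_sub_cancel_left] using hquad k _ (hxdD k)
  have hM0 : 0 ≤ M := (norm_nonneg _).trans (hM 0)
  have hR : ∀ k, ‖s.g k + s.B k (s.d k)‖ ≤ K + M * (C + C) := by
    intro k
    refine (norm_add_le _ _).trans (add_le_add (hg k) (((s.B k).le_opNorm _).trans ?_))
    refine mul_le_mul (hM k) ?_ (norm_nonneg _) hM0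
    have h1 : s.d k = s.x (k + 1) - s.x k := by rw [hx, add_sub_cancel_left]
    rw [h1]
    exact (norm_sub_le _ _).trans (add_le_add (hC _ (hxD _)) (hC _ (hxD _)))
  obtain ⟨Θ, hΘ⟩ := hrun.exists_theta_le hP hD_compact hxD hne hx hR hMFCQ
  obtain ⟨N, hN⟩ := eventually_atTop.1 (hrun.eventually_feasible hP hγ hx hΘ)
  -- The convergence result is applied to the run from index `N` on, where all iterates are feasible
  -- and both violations in the variational inequality vanish.
  obtain ⟨x', hx', q₀, hq₀, q₁, hq₁, hrate⟩ := hP.exists_tendsto_linear_rate hD_compact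
    (hK.continuousOn.mono hDO) (x := fun k => s.x (k + N)) (g := fun k => s.g (k + N))
    (d := fun k => s.d (k + N)) (B := fun k => s.B (k + N)) (fun k => hxD _)
    (fun k => by rw [← hx]; congr 1; omega) (fun k => hN _ (Nat.le_add_left _ _))
    (fun k => hg _) (fun k => hM _) (fun k => hB_pos _)
    (fun k y hy => (hquad _ y hy).trans (by gcongr))
    (fun k y hy => by
      have h1 := (hrun.multiplier (k + N)).le_inner hP (hrun.solution (k + N)).1 y
      rw [P.violation_eq_zero_iff.2 hy, ← hx,
        P.violation_eq_zero_iff.2 (hN (k + N + 1) (by omega)), mul_zero, sub_zero] at h1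
      rw [show k + 1 + N = k + N + 1 by omega]
      exact h1)
    hσ hl hbl hα hKL
  -- Dividing by q₀^N compensates for the shift by `N`.
  refine ⟨x', (tendsto_add_atTop_iff_nat N).1 hx', q₀, hq₀, q₁ / q₀ ^ N,
    div_pos hq₁ (pow_pos hq₀.1 N), ?_⟩
  obtain ⟨N', hN'⟩ := eventually_atTop.1 hrate
  refine eventually_atTop.2 ⟨N' + N, fun k hk => ?_⟩
  obtain ⟨m, rfl⟩ : ∃ m, k = m + N := ⟨k - N, by omega⟩
  refine (hN' m (by omega)).trans_eq ?_
  have := hq₀.1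
  rw [pow_add]
  field_simp
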